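/- **Theorem.** Existential monadic second order (EMSO) sentences about graphs are sentences of the form $\exists X_1\ldots\exists X_m\,\phi(X_1,\ldots,X_m)$, where $X_1,\dots,X_m$ (the monadic variables) range over sets of vertices and $\phi$ is a first order sentence in adjacency $\sim$, equality $=$ and the unary predicates $X_1,\ldots,X_m$. For a positive integer $a$ let $F_1$ be the simple path on $a$ vertices rooted at an end-point, let $F_2$ be the perfect $4$-ary tree with $a$ levels (the root, on level $0$; every vertex on levels $0,\dots,a-2$ has exactly $4$ children; $\frac{4^a-1}{3}$ vertices in total), and let $W_a$ be the graph obtained from the disjoint union of $F_1$ and $F_2$ by adding all edges $\{u,v\}$ with $u\in V(F_1)$, $v\in V(F_2)$ such that $u$ and $v$ are at the same distance from the roots of $F_1$ and $F_2$ respectively. Let $p\in(0,1)$ be a constant, and let $G(n,p)$ be the binomial random graph on $n$ vertices. 1. There is an EMSO sentence $\varphi_1=\exists X\,\phi(X)$ with only one monadic variable (and any number of first order variables) such that a finite non-empty graph $G$ satisfies $\varphi_1$ if and only if, for some positive integer $a$, there is an induced copy $F$ of $W_a$ in $G$ such that every vertex of $G$ outside $F$ has a neighbour in $F$; and the probability ${\sf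 P}(G(n,p)\models\varphi_1)$ does not converge as $n\to\infty$. 2. There is an EMSO sentence $\varphi_2$ with only three first order variables (each of which may be quantified repeatedly, and with any number of monadic variables) such that the probability ${\sf P}(G(n,p)\models\varphi_2)$ does not converge as $n\to\infty$. -/

import Mathlib

namespace EMSOGraph

/-- First-order formulas in the language of graphs (adjacency and equality) expanded by the unary
predicates (monadic variables) `X 0, …, X (m - 1)`, written with the `k` named first-order
variables `x 0, …, x (k - 1)`. A variable may be quantified repeatedly, so formulas over `k` names
are exactly the first-order formulas with (at most) `k` first-order variables. -/
inductive FOFormula (m k : ℕ) : Type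
  | adj (x y : Fin k) : FOFormula m k
  | eq (x y : Fin k) : FOFormula m k
  | mem (X : Fin m) (x : Fin k) : FOFormula m k
  | neg (φ : FOFormula m k) : FOFormula m k
  | and (φ ψ : FOFormula m k) : FOFormula m k
  | or (φ ψ : FOFormula m k) : FOFormula m k
  | imp (φ ψ : FOFormula m k) : FOFormula m k
  | iff (φ ψ : FOFormula m k) : FOFormula m k
  | all (x : Fin k) (φ : FOFormula m k) : FOFormula m k
  | ex (x : Fin k) (φ : FOFormula m k) : FOFormula m k

namespace FOFormula

variable {m k : ℕ}

/-- The first-order variables that occur free in a formula. -/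
def freeVars : FOFormula m k → Finset (Fin k)
  | adj x y => {x, y}
  | eq x y => {x, y}
  | mem _ x => {x}
  | neg φ => φ.freeVars
  | and φ ψ => φ.freeVars ∪ ψ.freeVars
  | or φ ψ => φ.freeVars ∪ ψ.freeVars
  | imp φ ψ => φ.freeVars ∪ ψ.freeVars
  | iff φ ψ => φ.freeVars ∪ ψ.freeVars
  | all x φ => φ.freeVars.erase x
  | ex x φ => φ.freeVars.erase x

/-- Satisfaction in the graph `G`, the monadic variables being interpreted by the vertex sets `S`
and the first-order variables by the vertices `v`. -/
def Realize {V : Type*} (G : SimpleGraph V) (S : Fin m → Set V) :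
    FOFormula m k → (Fin k → V) → Prop
  | adj x y, v => G.Adj (v x) (v y)
  | eq x y, v => v x = v y
  | mem X x, v => v x ∈ S X
  | neg φ, v => ¬ φ.Realize G S v
  | and φ ψ, v => φ.Realize G S v ∧ ψ.Realize G S v
  | or φ ψ, v => φ.Realize G S v ∨ ψ.Realize G S v
  | imp φ ψ, v => φ.Realize G S v → ψ.Realize G S v
  | iff φ ψ, v => (φ.Realize G S v ↔ ψ.Realize G S v)
  | all x φ, v => ∀ a : V, φ.Realize G S (Function.update v x a)
  | ex x φ, v => ∃ a : V, φ.Realize G S (Function.update v x a)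

end FOFormula

/-- An existential monadic second-order sentence `∃ X₁ … ∃ Xₘ φ(X₁, …, Xₘ)` with `m` monadic
variables, whose first-order part `φ` is a sentence written with `k` first-order variables. -/
structure EMSOSentence (m k : ℕ) where
  /-- The first-order part. -/
  body : FOFormula m k
  /-- The first-order part has no free first-order variables. -/
  closed : body.freeVars = ∅

/-- `G ⊨ ∃ X₁ … ∃ Xₘ φ(X₁, …, Xₘ)`. Structures are non-empty, as usual in model theory; since `φ` is
closed, its truth value on a non-empty vertex set does not depend on the assignment `v`. -/
def EMSOSentence.Models {m k : ℕ} {V : Type*} (G : SimpleGraph V) (φ : EMSOSentence m k) : Prop :=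
  ∃ S : Fin m → Set V, ∀ v : Fin k → V, φ.body.Realize G S v

/-- The product `F₁ · F₂` of graphs rooted at `r₁`, `r₂`: the disjoint union of `F₁` and `F₂`
together with all edges between a vertex of `F₁` and a vertex of `F₂` that are at the same distance
from the respective roots. -/
def rootedProduct {V₁ V₂ : Type*} (F₁ : SimpleGraph V₁) (r₁ : V₁) (F₂ : SimpleGraph V₂) (r₂ : V₂) :
    SimpleGraph (V₁ ⊕ V₂) where
  Adj
    | .inl u, .inl v => F₁.Adj u v
    | .inr u, .inr v => F₂.Adj u v
    | .inl u, .inr v => F₁.dist r₁ u = F₂.dist r₂ v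
    | .inr v, .inl u => F₁.dist r₁ u = F₂.dist r₂ v
  symm := ⟨by
    rintro (u | u) (v | v) h
    · exact F₁.adj_symm h
    · exact h
    · exact h
    · exact F₂.adj_symm h⟩
  loopless := ⟨by
    rintro (u | u) h
    · exact F₁.irrefl h
    · exact F₂.irrefl h⟩

/-- The perfect 4-ary tree with `a` levels. Its vertices are the words of length less than `a` over
a 4-letter alphabet; the children of a word `w` are the words `c :: w`. -/
def perfectTree (a : ℕ) : SimpleGraph {w : List (Fin 4) // w.length < a} where
  Adj u v := (∃ c : Fin 4, v.1 = c :: u.1) ∨ (∃ c : Fin 4, u.1 = c :: v.1)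
  symm := ⟨fun _ _ h => h.symm⟩
  loopless := ⟨by
    rintro u (⟨c, h⟩ | ⟨c, h⟩) <;> simpa using congrArg List.length h⟩

/-- The graph `W_a`: the product of the simple path on `a` vertices, rooted at an end-point, and the
perfect 4-ary tree with `a` levels, rooted at the empty word. -/
def graphW (a : ℕ+) :
    SimpleGraph (Fin (a : ℕ) ⊕ {w : List (Fin 4) // w.length < (a : ℕ)}) :=
  rootedProduct (SimpleGraph.pathGraph (a : ℕ)) ⟨0, a.pos⟩ (perfectTree (a : ℕ)) ⟨[], a.pos⟩

/-- `G` has an induced copy of `H` such that every vertex of `G` outside the copy has a neighbour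
in the copy. -/
def HasInducedDominatingCopy {U V : Type*} (H : SimpleGraph U) (G : SimpleGraph V) : Prop :=
  ∃ f : H ↪g G, ∀ v ∉ Set.range f, ∃ u : U, G.Adj v (f u)

/-- The probability that the binomial random graph `G(n, p)` satisfies `φ`. -/
noncomputable def prob {m k : ℕ} (φ : EMSOSentence m k) (p : unitInterval) (n : ℕ) : ℝ :=
  (SimpleGraph.binomialRandom (Fin n) p).real {G | φ.Models G}

/-- The real sequence `u` converges to a (finite) limit. -/
def Converges (u : ℕ → ℝ) : Prop :=
  ∃ L : ℝ, Filter.Tendsto u Filter.atTop (nhds L)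

end EMSOGraph

/-!
Both sentences say that a finite graph has a dominating induced copy of some `W_a`. A copy is
described by a path, a tree and a successor relation on the path such that every tree vertex is
joined to one path vertex, its level, and has exactly four children, on the successor of its level.
Distances from the roots need not be compared, so this description is first-order. With a single set
`X`, the path and the tree are told apart by their degrees in `X`: from the third vertex on, a path
vertex has at least sixteen neighbours on the tree, whereas a tree vertex has at most six neighbours
in all. With three first-order variables, degrees are not available, and instead further sets record
the position on the path modulo three and the number of a child among its siblings.

For the probabilities, let `N` be the order of `W_a`. As `W_a` is 2-degenerate, correlations between
its copies are weak, and for suitable `n`, exponential in `N`, the second moment method yields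
dominating copies with probability tending to one. For larger `n`, still exponential in `N`, no set
of at most `N` vertices dominates any more, while `W_{a+1}` has order at least `3 * N`, which is
more than the first moment allows for so sparse an induced subgraph. So the probability tends to
zero along a second sequence of values of `n`.
-/

namespace EMSOGraph

/-! ### Distances from the root and adjacency in `graphW` -/

section Height
variable {V : Type*} {G : SimpleGraph V} {h : V → ℕ}

theorem height_le_add_length (h_adj : ∀ u v, G.Adj u v → h v ≤ h u + 1) {u v : V}
    (w : G.Walk u v) : h v ≤ h u + w.length := by
  induction w with
  | nil => simp
  | cons huv w ih =>
    have := h_adj _ _ huv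
    rw [SimpleGraph.Walk.length_cons]
    omega

theorem exists_walk_length_eq_height {r : V} (h_root : ∀ v, h v = 0 → v = r)
    (h_pred : ∀ v, h v ≠ 0 → ∃ u, G.Adj u v ∧ h v = h u + 1) (v : V) :
    ∃ w : G.Walk r v, w.length = h v := by
  induction hn : h v generalizing v with
  | zero =>
    obtain rfl := h_root v hn
    exact ⟨.nil, rfl⟩
  | succ n ih =>
    obtain ⟨u, huv, hu⟩ := h_pred v (by omega)
    obtain ⟨w, hw⟩ := ih u (by omega)
    exact ⟨w.concat huv, by simp [hw]⟩

theorem dist_eq_height {r : V} (hr : h r = 0) (h_root : ∀ v, h v = 0 → v = r)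
    (h_adj : ∀ u v, G.Adj u v → h v ≤ h u + 1)
    (h_pred : ∀ v, h v ≠ 0 → ∃ u, G.Adj u v ∧ h v = h u + 1) (v : V) : G.dist r v = h v := by
  obtain ⟨w, hw⟩ := exists_walk_length_eq_height h_root h_pred v
  refine le_antisymm (hw ▸ SimpleGraph.dist_le w) ?_
  obtain ⟨w', hw'⟩ := w.reachable.exists_walk_length_eq_dist
  simpa [hr, hw'] using height_le_add_length h_adj w'

end Height

theorem pathGraph_dist_zero {a : ℕ} (ha : 0 < a) (i : Fin a) :
    (SimpleGraph.pathGraph a).dist ⟨0, ha⟩ i = i := by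
  refine dist_eq_height (h := Fin.val) rfl (fun v hv => Fin.ext hv) (fun u v huv => ?_)
    (fun v hv => ⟨⟨v - 1, by omega⟩, ?_, ?_⟩) i
  · rw [SimpleGraph.pathGraph_adj] at huv
    omega
  · rw [SimpleGraph.pathGraph_adj]
    exact Or.inl (Nat.succ_pred hv)
  · exact (Nat.succ_pred hv).symm

/-- The words of length less than `a` over a 4-letter alphabet, i.e. the vertices of
`perfectTree a`. -/
abbrev Word (a : ℕ) : Type := {w : List (Fin 4) // w.length < a}

/-- The vertices of `W_a`. -/
abbrev VertexW (a : ℕ) : Type := Fin a ⊕ Word a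

theorem perfectTree_dist_nil {a : ℕ} (ha : 0 < a) (w : Word a) :
    (perfectTree a).dist ⟨[], ha⟩ w = w.1.length := by
  refine dist_eq_height (h := fun w : Word a => w.1.length) rfl
    (fun v hv => Subtype.ext (List.length_eq_zero_iff.1 hv)) ?_ ?_ w
  · rintro u v (⟨c, h⟩ | ⟨c, h⟩)
    · simp [h]
    · simp only [h, List.length_cons]
      omega
  · rintro ⟨_ | ⟨c, v⟩, hv⟩ h
    · exact absurd rfl h
    · exact ⟨⟨v, (Nat.lt_succ_self _).trans hv⟩, Or.inl ⟨c, rfl⟩, rfl⟩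

section Adjacency
variable {a : ℕ+}

@[simp]
theorem graphW_adj_inl_inl {i j : Fin (a : ℕ)} :
    (graphW a).Adj (.inl i) (.inl j) ↔ (i : ℕ) + 1 = j ∨ (j : ℕ) + 1 = i :=
  SimpleGraph.pathGraph_adj

@[simp]
theorem graphW_adj_inl_inr {i : Fin (a : ℕ)} {w : Word a} :
    (graphW a).Adj (.inl i) (.inr w) ↔ (i : ℕ) = w.1.length := by
  change (SimpleGraph.pathGraph (a : ℕ)).dist ⟨0, a.pos⟩ i =
    (perfectTree (a : ℕ)).dist ⟨[], a.pos⟩ w ↔ _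
  rw [pathGraph_dist_zero, perfectTree_dist_nil]

@[simp]
theorem graphW_adj_inr_inl {i : Fin (a : ℕ)} {w : Word a} :
    (graphW a).Adj (.inr w) (.inl i) ↔ (i : ℕ) = w.1.length := by
  rw [SimpleGraph.adj_comm, graphW_adj_inl_inr]

@[simp]
theorem graphW_adj_inr_inr {u v : Word a} :
    (graphW a).Adj (.inr u) (.inr v) ↔ (∃ c, v.1 = c :: u.1) ∨ ∃ c, u.1 = c :: v.1 :=
  Iff.rfl

end Adjacency

/-- The first `a` levels of `W_b` span a copy of `W_a`. -/
def graphWEmbedding {a b : ℕ+} (hab : a ≤ b) : graphW a ↪g graphW b where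
  toFun := Sum.map (fun i => ⟨i, i.2.trans_le hab⟩) (fun w => ⟨w.1, w.2.trans_le hab⟩)
  inj' := by
    rintro (⟨i, hi⟩ | ⟨w, hw⟩) (⟨j, hj⟩ | ⟨w', hw'⟩) h <;> simp_all
  map_rel_iff' := by
    rintro (i | w) (j | w')
    · exact graphW_adj_inl_inl.trans (graphW_adj_inl_inl (i := i) (j := j)).symm
    · exact graphW_adj_inl_inr.trans (graphW_adj_inl_inr (i := i) (w := w')).symm
    · exact graphW_adj_inr_inl.trans (graphW_adj_inr_inl (i := j) (w := w)).symm
    · exact graphW_adj_inr_inr.trans (graphW_adj_inr_inr (u := w) (v := w')).symm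

/-! ### The order of `graphW` -/

/-- A nonempty word is a letter followed by a shorter word. -/
def wordSuccEquiv (a : ℕ) : Word (a + 1) ≃ Option (Fin 4 × Word a) where
  toFun
    | ⟨[], _⟩ => none
    | ⟨c :: w, h⟩ => some (c, ⟨w, by simpa using h⟩)
  invFun
    | none => ⟨[], by simp⟩
    | some (c, w) => ⟨c :: w.1, by simpa using w.2⟩
  left_inv := by rintro ⟨_ | ⟨c, w⟩, h⟩ <;> rfl
  right_inv := by rintro (_ | ⟨c, w, h⟩) <;> rfl

instance finite_word (a : ℕ) : Finite (Word a) :=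
  List.finite_length_lt (Fin 4) a

theorem card_word_succ (a : ℕ) : Nat.card (Word (a + 1)) = 4 * Nat.card (Word a) + 1 := by
  rw [Nat.card_congr (wordSuccEquiv a), Finite.card_option, Nat.card_prod, Nat.card_fin]

theorem two_mul_le_card_word_add_one (a : ℕ) : 2 * a ≤ Nat.card (Word a) + 1 := by
  induction a with
  | zero => simp
  | succ a ih =>
    rw [card_word_succ]
    rcases a with _ | a
    · simp
    · omega

/-- The number of vertices of `W_a`. -/
noncomputable def orderW (a : ℕ) : ℕ := Nat.card (VertexW a)

theorem orderW_eq (a : ℕ) : orderW a = a + Nat.card (Word a) := by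
  rw [orderW, Nat.card_sum, Nat.card_fin]

theorem le_orderW (a : ℕ) : a ≤ orderW a :=
  (Nat.le_add_right _ _).trans_eq (orderW_eq a).symm

theorem three_mul_orderW_le (a : ℕ) : 3 * orderW a ≤ orderW (a + 1) := by
  have := two_mul_le_card_word_add_one a
  rw [orderW_eq, orderW_eq, card_word_succ]
  omega

theorem orderW_mono : Monotone orderW :=
  monotone_nat_of_le_succ fun a => (Nat.le_mul_of_pos_left _ (by norm_num)).trans
    (three_mul_orderW_le a)

/-! ### An axiomatic description of induced copies of `graphW` -/

section Layering
variable {V : Type*}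

/-- The tree vertices on the level of the path vertex `u`. -/
def level (G : SimpleGraph V) (T : Set V) (u : V) : Set V := {t | t ∈ T ∧ G.Adj u t}

/-- `s` is a child of `t`: they are adjacent vertices of the tree `T` on consecutive levels, where
`nxt` is the successor relation on the path. -/
def IsChild (G : SimpleGraph V) (T : Set V) (nxt : V → V → Prop) (t s : V) : Prop :=
  t ∈ T ∧ s ∈ T ∧ G.Adj t s ∧ ∃ u v, G.Adj u t ∧ G.Adj v s ∧ nxt u v

/-- Conditions on a set `P` (the path), its end-point `r`, the successor relation `nxt` on the path
and a set `T` (the tree), saying that `P ∪ T` induces some `W_a`, except that the number of children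
is not specified. All of them are first-order in `P`, `T`, `r` and `nxt`. -/
structure IsPreLayering (G : SimpleGraph V) (P T : Set V) (r : V) (nxt : V → V → Prop) : Prop where
  notMem_tree : ∀ u, u ∈ P → u ∉ T
  root_mem : r ∈ P
  level_nonempty : ∀ u, u ∈ P → ∃ t, t ∈ T ∧ G.Adj u t
  exists_level : ∀ t, t ∈ T → ∃ u, u ∈ P ∧ G.Adj u t
  level_unique : ∀ t u u', t ∈ T → u ∈ P → u' ∈ P → G.Adj u t → G.Adj u' t → u = u'
  root_unique : ∀ t t', t ∈ T → t' ∈ T → G.Adj r t → G.Adj r t' → t = t'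
  nxt_spec : ∀ u v, nxt u v → u ∈ P ∧ v ∈ P ∧ G.Adj u v
  nxt_of_adj : ∀ u v, u ∈ P → v ∈ P → G.Adj u v → nxt u v ∨ nxt v u
  exists_pred : ∀ u, u ∈ P → u = r ∨ ∃ v, nxt v u
  succ_unique : ∀ u v w, nxt u v → nxt u w → v = w
  pred_unique : ∀ u v w, nxt v u → nxt w u → v = w
  child_of_adj : ∀ t s, t ∈ T → s ∈ T → G.Adj t s → IsChild G T nxt t s ∨ IsChild G T nxt s t
  exists_parent : ∀ s u, s ∈ T → u ∈ P → G.Adj u s → u = r ∨ ∃ t, IsChild G T nxt t s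
  parent_unique : ∀ s t t', IsChild G T nxt t s → IsChild G T nxt t' s → t = t'

/-- Conditions saying that `P ∪ T` induces some `W_a`, provided that the graph is finite: nothing
in them excludes an infinite path. -/
structure IsLayering (G : SimpleGraph V) (P T : Set V) (r : V) (nxt : V → V → Prop) : Prop
    extends IsPreLayering G P T r nxt where
  exists_children : ∀ t, t ∈ T → (∃ u v, G.Adj u t ∧ nxt u v) →
    ∃ c : Fin 4 → V, Function.Injective c ∧ ∀ s, IsChild G T nxt t s ↔ ∃ i, c i = s

variable {G : SimpleGraph V} {P T : Set V} {r u v t s : V} {nxt : V → V → Prop}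

namespace IsPreLayering

theorem left_mem (h : IsPreLayering G P T r nxt) (huv : nxt u v) : u ∈ P := (h.nxt_spec u v huv).1

theorem right_mem (h : IsPreLayering G P T r nxt) (huv : nxt u v) : v ∈ P :=
  (h.nxt_spec u v huv).2.1

theorem adj_iff_nxt_or_nxt (h : IsPreLayering G P T r nxt) (hu : u ∈ P) (hv : v ∈ P) :
    G.Adj u v ↔ nxt u v ∨ nxt v u :=
  ⟨h.nxt_of_adj u v hu hv, fun huv => huv.elim (fun huv => (h.nxt_spec _ _ huv).2.2)
    fun hvu => (h.nxt_spec _ _ hvu).2.2.symm⟩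

theorem exists_nxt_of_isChild (h : IsPreLayering G P T r nxt) (hts : IsChild G T nxt t s)
    (hu : u ∈ P) (hut : G.Adj u t) : ∃ v, nxt u v ∧ s ∈ level G T v := by
  obtain ⟨ht, hs, -, u', v, hu't, hvs, huv⟩ := hts
  obtain rfl := h.level_unique t u u' ht hu (h.left_mem huv) hut hu't
  exact ⟨v, huv, hs, hvs⟩

theorem exists_pred_of_isChild (h : IsPreLayering G P T r nxt) (hts : IsChild G T nxt t s)
    (hv : v ∈ P) (hvs : G.Adj v s) : ∃ u, nxt u v ∧ t ∈ level G T u := by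
  obtain ⟨ht, hs, -, u, v', hut, hv's, huv⟩ := hts
  obtain rfl := h.level_unique s v v' hs hv (h.right_mem huv) hvs hv's
  exact ⟨u, huv, ht, hut⟩

theorem ncard_level_root (h : IsPreLayering G P T r nxt) : (level G T r).ncard = 1 := by
  obtain ⟨t, ht, hrt⟩ := h.level_nonempty r h.root_mem
  refine Set.ncard_eq_one.2 ⟨t, Set.Subset.antisymm ?_ (Set.singleton_subset_iff.2 ⟨ht, hrt⟩)⟩
  exact fun s hs => h.root_unique s t hs.1 ht hs.2 hrt

end IsPreLayering

namespace IsLayering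

theorem exists_childMap (h : IsLayering G P T r nxt) :
    ∃ child : V → Fin 4 → V, ∀ t, t ∈ T → (∃ u v, G.Adj u t ∧ nxt u v) →
      Function.Injective (child t) ∧ ∀ s, IsChild G T nxt t s ↔ ∃ i, child t i = s := by
  have : Nonempty V := ⟨r⟩
  choose! child hchild using h.exists_children
  exact ⟨child, hchild⟩

/-- The children of a tree vertex in some order; arbitrary vertices on the last level. -/
noncomputable def childMap (h : IsLayering G P T r nxt) : V → Fin 4 → V := h.exists_childMap.choose

theorem childMap_injective (h : IsLayering G P T r nxt) (huv : nxt u v) (ht : t ∈ level G T u) :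
    Function.Injective (h.childMap t) :=
  (h.exists_childMap.choose_spec t ht.1 ⟨u, v, ht.2, huv⟩).1

theorem isChild_iff_exists_childMap_eq (h : IsLayering G P T r nxt) (huv : nxt u v)
    (ht : t ∈ level G T u) : IsChild G T nxt t s ↔ ∃ c, h.childMap t c = s :=
  (h.exists_childMap.choose_spec t ht.1 ⟨u, v, ht.2, huv⟩).2 s

theorem isChild_childMap (h : IsLayering G P T r nxt) (huv : nxt u v) (ht : t ∈ level G T u)
    (c : Fin 4) : IsChild G T nxt t (h.childMap t c) :=
  (h.isChild_iff_exists_childMap_eq huv ht).2 ⟨c, rfl⟩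

theorem childMap_mem_level (h : IsLayering G P T r nxt) (huv : nxt u v) (ht : t ∈ level G T u)
    (c : Fin 4) : h.childMap t c ∈ level G T v := by
  obtain ⟨v', huv', hs⟩ :=
    h.exists_nxt_of_isChild (h.isChild_childMap huv ht c) (h.left_mem huv) ht.2
  rwa [h.succ_unique u v v' huv huv']

theorem ne_root_of_nxt (h : IsLayering G P T r nxt) (huv : nxt u v) : v ≠ r := by
  rintro rfl
  obtain ⟨t, ht⟩ := h.level_nonempty u (h.left_mem huv)
  have hmem := h.childMap_mem_level huv (t := t) ht
  have h01 := h.root_unique _ _ (hmem 0).1 (hmem 1).1 (hmem 0).2 (hmem 1).2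
  exact zero_ne_one (h.childMap_injective huv ht h01)

theorem bijOn_childMap (h : IsLayering G P T r nxt) (huv : nxt u v) :
    Set.BijOn (fun x : Fin 4 × V => h.childMap x.2 x.1) (Set.univ ×ˢ level G T u)
      (level G T v) := by
  refine ⟨fun x hx => h.childMap_mem_level huv hx.2 _, ?_, fun s hs => ?_⟩
  · rintro ⟨c, t⟩ ⟨-, ht⟩ ⟨d, t'⟩ ⟨-, ht'⟩ hts
    dsimp only at ht ht' hts
    have hchild := h.isChild_childMap huv ht' d
    obtain rfl : t = t' :=
      h.parent_unique _ _ _ (h.isChild_childMap huv ht c) (hts ▸ hchild)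
    rw [h.childMap_injective huv ht hts]
  · obtain ⟨t, hts⟩ :=
      (h.exists_parent s v hs.1 (h.right_mem huv) hs.2).resolve_left (h.ne_root_of_nxt huv)
    obtain ⟨u', hu'v, ht⟩ := h.exists_pred_of_isChild hts (h.right_mem huv) hs.2
    obtain rfl := h.pred_unique v u u' huv hu'v
    obtain ⟨c, hc⟩ := (h.isChild_iff_exists_childMap_eq huv ht).1 hts
    exact ⟨(c, t), ⟨trivial, ht⟩, hc⟩

theorem ncard_level_of_nxt (h : IsLayering G P T r nxt) (huv : nxt u v) :
    (level G T v).ncard = 4 * (level G T u).ncard := by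
  rw [← (h.bijOn_childMap huv).image_eq, (h.bijOn_childMap huv).injOn.ncard_image,
    Set.ncard_prod, Set.ncard_univ, Nat.card_fin]

end IsLayering

/-! ### The depth of a path vertex -/

/-- The distance of `u` from the root along the path, read off from the number `4 ^ depth` of tree
vertices on its level. This makes the depth well defined before we know that `nxt` has no cycles. -/
noncomputable def depth (G : SimpleGraph V) (T : Set V) (u : V) : ℕ :=
  Nat.log 4 (level G T u).ncard

theorem IsPreLayering.depth_root (h : IsPreLayering G P T r nxt) : depth G T r = 0 := by
  rw [depth, h.ncard_level_root, Nat.log_one_right]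

namespace IsLayering

theorem depth_of_nxt [Finite V] (h : IsLayering G P T r nxt) (huv : nxt u v) :
    depth G T v = depth G T u + 1 := by
  have hpos : 0 < (level G T u).ncard :=
    (Set.ncard_pos (Set.toFinite _)).2 (h.level_nonempty u (h.left_mem huv))
  rw [depth, depth, h.ncard_level_of_nxt huv, mul_comm,
    Nat.log_mul_base (by norm_num) hpos.ne']

theorem exists_pred_of_depth_eq_succ (h : IsLayering G P T r nxt) (hu : u ∈ P) {n : ℕ}
    (hn : depth G T u = n + 1) : ∃ v, nxt v u := by
  refine (h.exists_pred u hu).resolve_left ?_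
  rintro rfl
  exact absurd (h.depth_root.symm.trans hn) n.succ_ne_zero.symm

theorem injOn_depth [Finite V] (h : IsLayering G P T r nxt) : Set.InjOn (depth G T) P := by
  intro u hu v hv huv
  induction hn : depth G T v generalizing u v with
  | zero =>
    have eq_root : ∀ w ∈ P, depth G T w = 0 → w = r := fun w hw hw0 =>
      (h.exists_pred w hw).resolve_right fun ⟨x, hx⟩ => by
        rw [h.depth_of_nxt hx] at hw0
        exact Nat.succ_ne_zero _ hw0
    rw [eq_root u hu (huv.trans hn), eq_root v hv hn]
  | succ n ih =>
    obtain ⟨u', hu'⟩ := h.exists_pred_of_depth_eq_succ hu (huv.trans hn)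
    obtain ⟨v', hv'⟩ := h.exists_pred_of_depth_eq_succ hv hn
    have hdu := h.depth_of_nxt hu'
    have hdv := h.depth_of_nxt hv'
    obtain rfl := ih (h.left_mem hu') (h.left_mem hv') (by omega) (by omega)
    exact h.succ_unique _ _ _ hu' hv'

theorem nxt_iff_depth_add_one_eq [Finite V] (h : IsLayering G P T r nxt) (hu : u ∈ P) (hv : v ∈ P) :
    nxt u v ↔ depth G T u + 1 = depth G T v := by
  refine ⟨fun huv => (h.depth_of_nxt huv).symm, fun huv => ?_⟩
  obtain ⟨u', hu'⟩ := h.exists_pred_of_depth_eq_succ hv huv.symm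
  have := h.depth_of_nxt hu'
  rwa [h.injOn_depth hu (h.left_mem hu') (by omega)]

theorem isLowerSet_image_depth [Finite V] (h : IsLayering G P T r nxt) :
    IsLowerSet (depth G T '' P) := by
  suffices hpred : ∀ n, n + 1 ∈ depth G T '' P → n ∈ depth G T '' P from
    fun _ _ hle hm => Nat.decreasingInduction' (fun k _ _ hk => hpred k hk) hle hm
  rintro n ⟨u, hu, hun⟩
  obtain ⟨v, hvu⟩ := h.exists_pred_of_depth_eq_succ hu hun
  have := h.depth_of_nxt hvu
  exact ⟨v, h.left_mem hvu, by omega⟩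

theorem exists_image_depth_eq_Iio [Finite V] (h : IsLayering G P T r nxt) :
    ∃ a : ℕ+, depth G T '' P = Set.Iio (a : ℕ) := by
  obtain ⟨_, ⟨m, hm, rfl⟩, hmax⟩ :=
    Set.exists_max_image (depth G T '' P) id (Set.toFinite _) ⟨_, r, h.root_mem, rfl⟩
  refine ⟨(depth G T m).succPNat,
    Set.Subset.antisymm (fun n hn => Nat.lt_succ_of_le (hmax n hn)) ?_⟩
  exact fun n hn => h.isLowerSet_image_depth (Nat.le_of_lt_succ hn) ⟨m, hm, rfl⟩

/-! ### The copy of `graphW` on a layering -/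

/-- The tree vertex reached from the root of the tree along the letters of a word, the last letter
first. -/
noncomputable def treeVertex (h : IsLayering G P T r nxt) : List (Fin 4) → V
  | [] => (h.level_nonempty r h.root_mem).choose
  | c :: w => h.childMap (h.treeVertex w) c

theorem bijOn_treeVertex [Finite V] (h : IsLayering G P T r nxt) (hu : u ∈ P) :
    Set.BijOn h.treeVertex {w | w.length = depth G T u} (level G T u) := by
  induction hn : depth G T u generalizing u with
  | zero =>
    obtain rfl := h.injOn_depth hu h.root_mem (hn.trans h.depth_root.symm)
    have hmem : h.treeVertex [] ∈ level G T u := (h.level_nonempty u h.root_mem).choose_spec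
    have hlevel : level G T u = {h.treeVertex []} :=
      Set.Subset.antisymm (fun t ht => h.root_unique _ _ ht.1 hmem.1 ht.2 hmem.2)
        (Set.singleton_subset_iff.2 hmem)
    simp only [List.length_eq_zero_iff, hlevel]
    exact Set.bijOn_singleton.2 rfl
  | succ n ih =>
    obtain ⟨v, hvu⟩ := h.exists_pred_of_depth_eq_succ hu hn
    have := h.depth_of_nxt hvu
    have hv := ih (h.left_mem hvu) (by omega)
    have hchild := h.bijOn_childMap hvu
    refine ⟨?_, ?_, fun s hs => ?_⟩
    · rintro (_ | ⟨c, w⟩) hw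
      · simp at hw
      · exact hchild.mapsTo (x := (c, h.treeVertex w)) ⟨trivial, hv.mapsTo (Nat.succ_injective hw)⟩
    · rintro (_ | ⟨c, w⟩) hw (_ | ⟨d, w'⟩) hw' heq
      · rfl
      · simp at hw
      · simp at hw'
      · have hw := Nat.succ_injective hw
        have hw' := Nat.succ_injective hw'
        have hpair : (c, h.treeVertex w) = (d, h.treeVertex w') :=
          hchild.injOn ⟨trivial, hv.mapsTo hw⟩ ⟨trivial, hv.mapsTo hw'⟩ heq
        obtain ⟨hcd, hww'⟩ := Prod.mk.inj hpair
        rw [hcd, hv.injOn hw hw' hww']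
    · obtain ⟨⟨c, t⟩, ⟨-, ht⟩, rfl⟩ := hchild.surjOn hs
      obtain ⟨w, hw, rfl⟩ := hv.surjOn ht
      exact ⟨c :: w, congrArg Nat.succ hw, rfl⟩

theorem treeVertex_mem [Finite V] (h : IsLayering G P T r nxt) {w : List (Fin 4)}
    (hw : w.length ∈ depth G T '' P) : h.treeVertex w ∈ T := by
  obtain ⟨u, hu, hwu⟩ := hw
  exact ((h.bijOn_treeVertex hu).mapsTo hwu.symm).1

theorem adj_treeVertex_iff [Finite V] (h : IsLayering G P T r nxt) {w : List (Fin 4)}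
    (hu : u ∈ P) (hw : w.length ∈ depth G T '' P) :
    G.Adj u (h.treeVertex w) ↔ depth G T u = w.length := by
  obtain ⟨v, hv, hwv⟩ := hw
  have hmem := (h.bijOn_treeVertex hv).mapsTo hwv.symm
  refine ⟨fun hadj => ?_, fun hdepth => ?_⟩
  · rw [h.level_unique _ _ _ hmem.1 hu hv hadj hmem.2, hwv]
  · rw [h.injOn_depth hu hv (hdepth.trans hwv.symm)]
    exact hmem.2

theorem treeVertex_injOn [Finite V] (h : IsLayering G P T r nxt) :
    Set.InjOn h.treeVertex {w | w.length ∈ depth G T '' P} := by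
  rintro w ⟨u, hu, hwu⟩ w' hw' heq
  have hadj := ((h.bijOn_treeVertex hu).mapsTo hwu.symm).2
  rw [heq, h.adj_treeVertex_iff hu hw'] at hadj
  exact (h.bijOn_treeVertex hu).injOn hwu.symm hadj.symm heq

theorem isChild_treeVertex_iff [Finite V] (h : IsLayering G P T r nxt) {w w' : List (Fin 4)}
    (hw : w.length ∈ depth G T '' P) (hw' : w'.length ∈ depth G T '' P) :
    IsChild G T nxt (h.treeVertex w) (h.treeVertex w') ↔ ∃ c, w' = c :: w := by
  obtain ⟨u, hu, hwu⟩ := id hw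
  have hmem := (h.bijOn_treeVertex hu).mapsTo hwu.symm
  constructor
  · intro hchild
    obtain ⟨v, huv, -⟩ := h.exists_nxt_of_isChild hchild hu hmem.2
    obtain ⟨c, hc⟩ := (h.isChild_iff_exists_childMap_eq huv hmem).1 hchild
    have hcw : (c :: w).length ∈ depth G T '' P :=
      ⟨v, h.right_mem huv, by rw [h.depth_of_nxt huv, hwu, List.length_cons]⟩
    exact ⟨c, h.treeVertex_injOn hw' hcw hc.symm⟩
  · rintro ⟨c, rfl⟩
    obtain ⟨v, hv, hwv⟩ := hw'
    have huv : nxt u v := (h.nxt_iff_depth_add_one_eq hu hv).2 (by rw [hwu, hwv, List.length_cons])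
    exact h.isChild_childMap huv hmem c

theorem adj_treeVertex_treeVertex_iff [Finite V] (h : IsLayering G P T r nxt)
    {w w' : List (Fin 4)} (hw : w.length ∈ depth G T '' P) (hw' : w'.length ∈ depth G T '' P) :
    G.Adj (h.treeVertex w) (h.treeVertex w') ↔ (∃ c, w' = c :: w) ∨ ∃ c, w = c :: w' := by
  rw [← h.isChild_treeVertex_iff hw hw', ← h.isChild_treeVertex_iff hw' hw]
  exact ⟨h.child_of_adj _ _ (h.treeVertex_mem hw) (h.treeVertex_mem hw'),
    fun hadj => hadj.elim (fun hc => hc.2.2.1) fun hc => hc.2.2.1.symm⟩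

theorem exists_embedding [Finite V] (h : IsLayering G P T r nxt) :
    ∃ (a : ℕ+) (f : graphW a ↪g G), Set.range f = P ∪ T := by
  obtain ⟨a, ha⟩ := h.exists_image_depth_eq_Iio
  have hword (w : Word a) : w.1.length ∈ depth G T '' P := ha ▸ w.2
  choose path path_mem depth_path using fun i : Fin (a : ℕ) => (ha ▸ i.2 : (i : ℕ) ∈ depth G T '' P)
  let F : VertexW a → V := Sum.elim path fun w => h.treeVertex w.1
  have F_inj : Function.Injective F := by
    refine Function.Injective.sumElim (fun i j hij => ?_) (fun w w' hww' => ?_) fun i w hiw => ?_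
    · rw [Fin.ext_iff, ← depth_path, ← depth_path, hij]
    · exact Subtype.ext (h.treeVertex_injOn (hword w) (hword w') hww')
    · exact h.notMem_tree _ (path_mem i) (hiw ▸ h.treeVertex_mem (hword w))
  have F_adj : ∀ x y, G.Adj (F x) (F y) ↔ (graphW a).Adj x y := by
    rintro (i | w) (j | w')
    · rw [graphW_adj_inl_inl, ← depth_path i, ← depth_path j,
        ← h.nxt_iff_depth_add_one_eq (path_mem i) (path_mem j),
        ← h.nxt_iff_depth_add_one_eq (path_mem j) (path_mem i)]
      exact h.adj_iff_nxt_or_nxt (path_mem i) (path_mem j)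
    · rw [graphW_adj_inl_inr, ← depth_path i]
      exact h.adj_treeVertex_iff (path_mem i) (hword w')
    · rw [graphW_adj_inr_inl, ← depth_path j, G.adj_comm]
      exact h.adj_treeVertex_iff (path_mem j) (hword w)
    · exact h.adj_treeVertex_treeVertex_iff (hword w) (hword w')
  refine ⟨a, ⟨⟨F, F_inj⟩, fun {x y} => F_adj x y⟩, Set.Subset.antisymm ?_ ?_⟩
  · rintro _ ⟨i | w, rfl⟩
    · exact Or.inl (path_mem i)
    · exact Or.inr (h.treeVertex_mem (hword w))
  · have depth_lt {u : V} (hu : u ∈ P) : depth G T u < a := ha.subset ⟨u, hu, rfl⟩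
    rintro x (hx | hx)
    · exact ⟨.inl ⟨_, depth_lt hx⟩, h.injOn_depth (path_mem _) hx (depth_path _)⟩
    · obtain ⟨u, hu, hux⟩ := h.exists_level x hx
      obtain ⟨w, hw, rfl⟩ := (h.bijOn_treeVertex hu).surjOn ⟨hx, hux⟩
      exact ⟨.inr ⟨w, hw.trans_lt (depth_lt hu)⟩, rfl⟩

end IsLayering
end Layering

/-! ### The layering of a copy of `graphW` -/

section Copy
variable {V : Type*} {G : SimpleGraph V} {a : ℕ+} (f : graphW a ↪g G)

/-- The path of a copy of `W_a`. -/
def copyPath : Set V := Set.range fun i => f (.inl i)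

/-- The tree of a copy of `W_a`. -/
def copyTree : Set V := Set.range fun w => f (.inr w)

/-- The end-point of the path of a copy of `W_a`. -/
def copyRoot : V := f (.inl ⟨0, a.pos⟩)

/-- The successor relation on the path of a copy of `W_a`. -/
def copyNxt (x y : V) : Prop :=
  ∃ i j : Fin (a : ℕ), (i : ℕ) + 1 = j ∧ f (.inl i) = x ∧ f (.inl j) = y

theorem range_copy : Set.range f = copyPath f ∪ copyTree f :=
  Set.ext fun x => by simp [copyPath, copyTree]

theorem disjoint_copyPath_copyTree : Disjoint (copyPath f) (copyTree f) := by
  rw [Set.disjoint_left]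
  rintro _ ⟨i, rfl⟩ ⟨w, hw⟩
  exact Sum.inr_ne_inl (f.injective hw)

variable {f}

theorem copyNxt_iff {i j : Fin (a : ℕ)} :
    copyNxt f (f (.inl i)) (f (.inl j)) ↔ (i : ℕ) + 1 = j := by
  simp [copyNxt]

theorem copyNxt_right_unique {x y z : V} (hxy : copyNxt f x y) (hxz : copyNxt f x z) : y = z := by
  obtain ⟨i, j, hij, rfl, rfl⟩ := hxy
  obtain ⟨i', j', hij', hi, rfl⟩ := hxz
  obtain rfl : i' = i := Sum.inl_injective (f.injective hi)
  rw [Fin.ext (hij.symm.trans hij')]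

theorem copyNxt_left_unique {x y z : V} (hyx : copyNxt f y x) (hzx : copyNxt f z x) : y = z := by
  obtain ⟨i, j, hij, rfl, rfl⟩ := hyx
  obtain ⟨i', j', hij', rfl, hj⟩ := hzx
  obtain rfl : j' = j := Sum.inl_injective (f.injective hj)
  rw [Fin.ext (Nat.succ_injective (hij.trans hij'.symm))]

theorem isChild_copyTree_iff {x y : V} : IsChild G (copyTree f) (copyNxt f) x y ↔
    ∃ w w' : Word a, (∃ c, w'.1 = c :: w.1) ∧ f (.inr w) = x ∧ f (.inr w') = y := by
  constructor
  · rintro ⟨⟨w, rfl⟩, ⟨w', rfl⟩, hadj, _, _, hu, hv, i, j, hij, rfl, rfl⟩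
    simp only [f.map_adj_iff, graphW_adj_inl_inr, graphW_adj_inr_inr] at hadj hu hv
    refine ⟨w, w', hadj.resolve_right ?_, rfl, rfl⟩
    rintro ⟨c, hc⟩
    have := congrArg List.length hc
    rw [List.length_cons] at this
    omega
  · rintro ⟨w, w', ⟨c, hc⟩, rfl, rfl⟩
    exact ⟨⟨w, rfl⟩, ⟨w', rfl⟩, by simp [hc], f (.inl ⟨_, w.2⟩), f (.inl ⟨_, w'.2⟩), by simp,
      by simp, copyNxt_iff.2 (by simp [hc])⟩

theorem isChild_copy_iff {w : Word a} {s : V} :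
    IsChild G (copyTree f) (copyNxt f) (f (.inr w)) s ↔
      ∃ (c : Fin 4) (hc : (c :: w.1).length < (a : ℕ)), f (.inr ⟨c :: w.1, hc⟩) = s := by
  rw [isChild_copyTree_iff]
  constructor
  · rintro ⟨v, ⟨_, hv'⟩, ⟨c, rfl⟩, hv, rfl⟩
    obtain rfl : v = w := Sum.inr_injective (f.injective hv)
    exact ⟨c, hv', rfl⟩
  · rintro ⟨c, hc, rfl⟩
    exact ⟨w, _, ⟨c, rfl⟩, rfl, rfl⟩

theorem isChild_copy_left_unique {x y z : V} (hyx : IsChild G (copyTree f) (copyNxt f) y x)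
    (hzx : IsChild G (copyTree f) (copyNxt f) z x) : y = z := by
  obtain ⟨w, v, ⟨c, hc⟩, rfl, rfl⟩ := isChild_copyTree_iff.1 hyx
  obtain ⟨w', v', ⟨d, hd⟩, rfl, hv⟩ := isChild_copyTree_iff.1 hzx
  obtain rfl : v' = v := Sum.inr_injective (f.injective hv)
  rw [Subtype.ext (List.cons.inj (hc.symm.trans hd)).2]

theorem exists_isChild_copy {x u : V} (hx : x ∈ copyTree f) (hu : u ∈ copyPath f)
    (hux : G.Adj u x) : u = copyRoot f ∨ ∃ y, IsChild G (copyTree f) (copyNxt f) y x := by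
  obtain ⟨⟨_ | ⟨c, w⟩, hw⟩, rfl⟩ := hx
  · obtain ⟨i, rfl⟩ := hu
    obtain rfl : i = ⟨0, a.pos⟩ := Fin.ext (graphW_adj_inl_inr.1 (f.map_adj_iff.1 hux))
    exact Or.inl rfl
  · exact Or.inr ⟨f (.inr ⟨w, (Nat.lt_succ_self _).trans hw⟩), isChild_copy_iff.2 ⟨c, hw, rfl⟩⟩

variable (f)

theorem isPreLayering_copy :
    IsPreLayering G (copyPath f) (copyTree f) (copyRoot f) (copyNxt f) where
  notMem_tree _ hu := (disjoint_copyPath_copyTree f).notMem_of_mem_left hu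
  root_mem := ⟨_, rfl⟩
  level_nonempty := by
    rintro _ ⟨i, rfl⟩
    exact ⟨_, ⟨⟨List.replicate i 0, by simp⟩, rfl⟩, by simp⟩
  exists_level := by
    rintro _ ⟨w, rfl⟩
    exact ⟨_, ⟨⟨w.1.length, w.2⟩, rfl⟩, by simp⟩
  level_unique := by
    rintro _ _ _ ⟨w, rfl⟩ ⟨i, rfl⟩ ⟨j, rfl⟩ hi hj
    simp only [f.map_adj_iff, graphW_adj_inl_inr] at hi hj
    rw [Fin.ext (hi.trans hj.symm)]
  root_unique := by
    rintro _ _ ⟨w, rfl⟩ ⟨w', rfl⟩ hw hw'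
    simp only [copyRoot, f.map_adj_iff, graphW_adj_inl_inr] at hw hw'
    rw [Subtype.ext ((List.length_eq_zero_iff.1 hw.symm).trans
      (List.length_eq_zero_iff.1 hw'.symm).symm)]
  nxt_spec := by
    rintro _ _ ⟨i, j, hij, rfl, rfl⟩
    exact ⟨⟨i, rfl⟩, ⟨j, rfl⟩, by simp [hij]⟩
  nxt_of_adj := by
    rintro _ _ ⟨i, rfl⟩ ⟨j, rfl⟩ hij
    simpa only [f.map_adj_iff, graphW_adj_inl_inl, copyNxt_iff] using hij
  exists_pred := by
    rintro _ ⟨⟨_ | i, hi⟩, rfl⟩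
    · exact Or.inl rfl
    · exact Or.inr ⟨f (.inl ⟨i, (Nat.lt_succ_self i).trans hi⟩), copyNxt_iff.2 rfl⟩
  succ_unique _ _ _ := copyNxt_right_unique
  pred_unique _ _ _ := copyNxt_left_unique
  child_of_adj := by
    rintro _ _ ⟨w, rfl⟩ ⟨w', rfl⟩ h
    rw [f.map_adj_iff, graphW_adj_inr_inr] at h
    rw [isChild_copyTree_iff, isChild_copyTree_iff]
    exact h.imp (fun h => ⟨w, w', h, rfl, rfl⟩) (fun h => ⟨w', w, h, rfl, rfl⟩)
  exists_parent _ _ := exists_isChild_copy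
  parent_unique _ _ _ := isChild_copy_left_unique

theorem isLayering_copy : IsLayering G (copyPath f) (copyTree f) (copyRoot f) (copyNxt f) where
  toIsPreLayering := isPreLayering_copy f
  exists_children := by
    rintro _ ⟨w, rfl⟩ ⟨_, _, hu, i, j, hij, rfl, rfl⟩
    have hw : w.1.length + 1 < a := by
      rw [f.map_adj_iff, graphW_adj_inl_inr] at hu
      omega
    refine ⟨fun c => f (.inr ⟨c :: w.1, hw⟩), fun c d hcd => ?_, fun s => ?_⟩
    · simpa using f.injective hcd
    · rw [isChild_copy_iff]
      exact ⟨fun ⟨c, _, hs⟩ => ⟨c, hs⟩, fun ⟨c, hs⟩ => ⟨c, hw, hs⟩⟩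

end Copy

theorem hasInducedDominatingCopy_iff {U V : Type*} {H : SimpleGraph U} {G : SimpleGraph V} :
    HasInducedDominatingCopy H G ↔
      ∃ f : H ↪g G, ∀ x, x ∈ Set.range f ∨ ∃ y, y ∈ Set.range f ∧ G.Adj x y := by
  simp only [HasInducedDominatingCopy, Set.exists_range_iff, or_iff_not_imp_left]

theorem IsLayering.exists_hasInducedDominatingCopy {V : Type*} [Finite V] {G : SimpleGraph V}
    {P T : Set V} {r : V} {nxt : V → V → Prop} (h : IsLayering G P T r nxt)
    (hdom : ∀ x, x ∈ P ∪ T ∨ ∃ y, y ∈ P ∪ T ∧ G.Adj x y) :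
    ∃ a : ℕ+, HasInducedDominatingCopy (graphW a) G := by
  obtain ⟨a, f, hf⟩ := h.exists_embedding
  exact ⟨a, hasInducedDominatingCopy_iff.2 ⟨f, hf.symm ▸ hdom⟩⟩

/-! ### Building formulas -/

local notation:35 φ:36 " ⋏ " ψ:35 => FOFormula.and φ ψ
local notation:30 φ:31 " ⋎ " ψ:30 => FOFormula.or φ ψ
local notation:25 φ:26 " ⟹ " ψ:25 => FOFormula.imp φ ψ

namespace FOFormula

variable {m k : ℕ} {V : Type*} {G : SimpleGraph V} {S : Fin m → Set V} {v : Fin k → V}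

/-- The conjunction of a list of formulas. -/
def conj [NeZero k] (l : List (FOFormula m k)) : FOFormula m k := l.foldr and (eq 0 0)

/-- The disjunction of a list of formulas. -/
def disj [NeZero k] (l : List (FOFormula m k)) : FOFormula m k := l.foldr or (neg (eq 0 0))

/-- Existential quantification over a list of variables. -/
def exs (l : List (Fin k)) (φ : FOFormula m k) : FOFormula m k := l.foldr ex φ

/-- The formula saying that the variables `c 0, c 1, …` have pairwise distinct values. -/
def distinct [NeZero k] {j : ℕ} (c : Fin j → Fin k) : FOFormula m k :=
  conj ((List.finRange j).map fun s => conj (((List.finRange j).filter (s ≠ ·)).map fun t =>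
    neg (eq (c s) (c t))))

/-- The universal closure of a formula. -/
def close (φ : FOFormula m k) : FOFormula m k := (List.finRange k).foldr all φ

theorem realize_conj [NeZero k] {l : List (FOFormula m k)} :
    (conj l).Realize G S v ↔ ∀ φ ∈ l, φ.Realize G S v := by
  induction l with
  | nil => simp [conj, Realize]
  | cons φ l ih =>
    rw [List.forall_mem_cons, ← ih]
    rfl

theorem realize_disj [NeZero k] {l : List (FOFormula m k)} :
    (disj l).Realize G S v ↔ ∃ φ ∈ l, φ.Realize G S v := by
  induction l with
  | nil => simp [disj, Realize]
  | cons φ l ih =>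
    rw [List.exists_mem_cons_iff, ← ih]
    rfl

theorem realize_exs {l : List (Fin k)} {φ : FOFormula m k} :
    (exs l φ).Realize G S v ↔ ∃ w, (∀ i, i ∉ l → w i = v i) ∧ φ.Realize G S w := by
  induction l generalizing v with
  | nil =>
    refine ⟨fun h => ⟨v, fun _ _ => rfl, h⟩, ?_⟩
    rintro ⟨w, hw, h⟩
    obtain rfl : w = v := funext fun i => hw i List.not_mem_nil
    exact h
  | cons j l ih =>
    change (∃ b, (exs l φ).Realize G S (Function.update v j b)) ↔ _
    simp only [ih]
    constructor
    · rintro ⟨b, w, hw, h⟩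
      refine ⟨w, fun i hi => ?_, h⟩
      rw [List.mem_cons, not_or] at hi
      rw [hw i hi.2, Function.update_of_ne hi.1]
    · rintro ⟨w, hw, h⟩
      refine ⟨w j, w, fun i hi => ?_, h⟩
      by_cases hij : i = j
      · rw [hij, Function.update_self]
      · rw [Function.update_of_ne hij, hw i (by simp [hij, hi])]

theorem realize_exs_ofFn {j : ℕ} {c : Fin j → Fin k} (hc : Function.Injective c)
    {φ : FOFormula m k} : (exs (List.ofFn c) φ).Realize G S v ↔
      ∃ y : Fin j → V, φ.Realize G S (Function.extend c y v) := by
  simp only [realize_exs, List.mem_ofFn]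
  constructor
  · rintro ⟨w, hw, h⟩
    refine ⟨w ∘ c, ?_⟩
    convert h
    ext i
    by_cases hi : ∃ t, c t = i
    · obtain ⟨t, rfl⟩ := hi
      rw [hc.extend_apply, Function.comp_apply]
    · rw [Function.extend_apply' _ _ _ hi, hw i hi]
  · rintro ⟨y, h⟩
    exact ⟨_, fun i hi => Function.extend_apply' _ _ _ hi, h⟩

theorem realize_distinct [NeZero k] {j : ℕ} {c : Fin j → Fin k} :
    (distinct c).Realize G S v ↔ Function.Injective fun t => v (c t) := by
  simp only [distinct, realize_conj, List.mem_map, List.mem_finRange, true_and,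
    forall_exists_index, forall_apply_eq_imp_iff, List.mem_filter, decide_eq_true_eq, Realize,
    and_imp, forall_apply_eq_imp_iff₂]
  exact ⟨fun h s t hst => by_contra fun hne => h s t hne hst, fun h s t hne hst => hne (h hst)⟩

theorem notMem_freeVars_foldr_all (φ : FOFormula m k) {l : List (Fin k)} {i : Fin k} (hi : i ∈ l) :
    i ∉ (l.foldr all φ).freeVars := by
  induction l with
  | nil => simp at hi
  | cons j l ih =>
    simp only [List.foldr_cons, freeVars, Finset.mem_erase, not_and]
    exact fun hij => ih ((List.mem_cons.1 hi).resolve_left hij)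

theorem freeVars_close (φ : FOFormula m k) : φ.close.freeVars = ∅ :=
  Finset.eq_empty_of_forall_notMem fun i => φ.notMem_freeVars_foldr_all (List.mem_finRange i)

theorem forall_realize_close (φ : FOFormula m k) :
    (∀ v, φ.close.Realize G S v) ↔ ∀ v, φ.Realize G S v := by
  unfold close
  induction List.finRange k with
  | nil => rfl
  | cons j l ih =>
    rw [← ih, List.foldr_cons]
    refine ⟨fun h v => ?_, fun h v b => h _⟩
    rw [← Function.update_eq_self j v]
    exact h v (v j)

/-- The sentence whose first-order part is the universal closure of a formula. -/
def toSentence (φ : FOFormula m k) : EMSOSentence m k where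
  body := φ.close
  closed := φ.freeVars_close

theorem models_toSentence [Nonempty V] {φ : FOFormula m k} {Q : (Fin m → Set V) → Prop}
    (h : ∀ S v, φ.Realize G S v ↔ Q S) : φ.toSentence.Models G ↔ ∃ S, Q S := by
  simp only [EMSOSentence.Models, toSentence, forall_realize_close, h, forall_const]

end FOFormula

/-! ### The first-order description of a layering -/

section PreLayering
variable {m k : ℕ}

/-- The formula saying that `y` is a child of `x`, with auxiliary variable `z`. -/
def childFormula (tree : Fin k → FOFormula m k) (nxt : Fin k → Fin k → FOFormula m k)
    (x y z : Fin k) : FOFormula m k :=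
  -- `x` is the parent outside the inner quantifier over `x` and a path vertex inside it.
  tree x ⋏ tree y ⋏ .adj x y ⋏ .ex z (.adj z x ⋏ .ex x (.adj x y ⋏ nxt z x))

/-- The formula expressing `IsPreLayering`, written with the variables `x`, `y`, `z`. -/
def preLayeringFormula [NeZero k] (path tree root : Fin k → FOFormula m k)
    (nxt : Fin k → Fin k → FOFormula m k) (x y z : Fin k) : FOFormula m k :=
  .conj [
    .all x (path x ⟹ .neg (tree x)),
    .all x (root x ⟹ path x),
    .all x (path x ⟹ .ex y (tree y ⋏ .adj x y)),
    .all x (tree x ⟹ .ex y (path y ⋏ .adj y x)),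
    .all x (.all y (.all z
      (tree x ⟹ path y ⟹ path z ⟹ .adj y x ⟹ .adj z x ⟹ .eq y z))),
    .all x (.all y (tree x ⟹ tree y ⟹
      .ex z (root z ⋏ .adj z x) ⟹ .ex z (root z ⋏ .adj z y) ⟹ .eq x y)),
    .all x (.all y (nxt x y ⟹ path x ⋏ path y ⋏ .adj x y)),
    .all x (.all y (path x ⟹ path y ⟹ .adj x y ⟹ nxt x y ⋎ nxt y x)),
    .all x (path x ⟹ root x ⋎ .ex y (nxt y x)),
    .all x (.all y (.all z (nxt x y ⟹ nxt x z ⟹ .eq y z))),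
    .all x (.all y (.all z (nxt y x ⟹ nxt z x ⟹ .eq y z))),
    .all x (.all y (tree x ⟹ tree y ⟹ .adj x y ⟹
      childFormula tree nxt x y z ⋎ childFormula tree nxt y x z)),
    .all x (.all y (tree x ⟹ path y ⟹ .adj y x ⟹
      root y ⋎ .ex z (childFormula tree nxt z x y))),
    .all x (.all y (.all z
      (childFormula tree nxt y x z ⟹ childFormula tree nxt z x y ⟹ .eq y z)))]

/-- On the assignments in `E`, the formulas `path i`, `tree i`, `root i`, `nxt i j` in variables
`i`, `j` from `A` define the sets `P` and `T`, the vertex `r` and the relation `N`. -/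
structure Interprets {V : Type*} (G : SimpleGraph V) (S : Fin m → Set V) (E : Set (Fin k → V))
    (A : Set (Fin k)) (path tree root : Fin k → FOFormula m k)
    (nxt : Fin k → Fin k → FOFormula m k) (P T : Set V) (r : V) (N : V → V → Prop) : Prop where
  update : ∀ w ∈ E, ∀ i ∈ A, ∀ b, Function.update w i b ∈ E
  path : ∀ w ∈ E, ∀ i ∈ A, ((path i).Realize G S w ↔ w i ∈ P)
  tree : ∀ w ∈ E, ∀ i ∈ A, ((tree i).Realize G S w ↔ w i ∈ T)
  root : ∀ w ∈ E, ∀ i ∈ A, ((root i).Realize G S w ↔ w i = r)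
  nxt : ∀ w ∈ E, ∀ i ∈ A, ∀ j ∈ A, ((nxt i j).Realize G S w ↔ N (w i) (w j))

variable {path tree root : Fin k → FOFormula m k} {nxt : Fin k → Fin k → FOFormula m k}
  {V : Type*} {G : SimpleGraph V} {S : Fin m → Set V} {E : Set (Fin k → V)} {A : Set (Fin k)}
  {P T : Set V} {r : V} {N : V → V → Prop}

namespace Interprets

theorem realize_child (I : Interprets G S E A path tree root nxt P T r N) {x y z : Fin k}
    (hx : x ∈ A) (hy : y ∈ A) (hz : z ∈ A) (hxy : x ≠ y) (hxz : x ≠ z) (hyz : y ≠ z)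
    {w : Fin k → V} (hw : w ∈ E) :
    (childFormula tree nxt x y z).Realize G S w ↔ IsChild G T N (w x) (w y) := by
  simp only [childFormula, IsChild, FOFormula.Realize, I.tree w hw x hx, I.tree w hw y hy]
  simp (maxDischargeDepth := 8) only [I.nxt, I.update, hw, hx, hz, Function.update_self,
    Function.update_of_ne hxz.symm, Function.update_of_ne hxz, Function.update_of_ne hyz,
    Function.update_of_ne hxy.symm, exists_and_left]

theorem realize_preLayering [NeZero k] (I : Interprets G S E A path tree root nxt P T r N)
    {x y z : Fin k} (hx : x ∈ A) (hy : y ∈ A) (hz : z ∈ A) (hxy : x ≠ y) (hxz : x ≠ z)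
    (hyz : y ≠ z) {w : Fin k → V} (hw : w ∈ E) :
    (preLayeringFormula path tree root nxt x y z).Realize G S w ↔ IsPreLayering G P T r N := by
  have child_xyz := fun w hw => I.realize_child hx hy hz hxy hxz hyz (w := w) hw
  have child_yxz := fun w hw => I.realize_child hy hx hz hxy.symm hyz hxz (w := w) hw
  have child_zxy := fun w hw => I.realize_child hz hx hy hxz.symm hyz.symm hxy (w := w) hw
  rw [preLayeringFormula, FOFormula.realize_conj]
  simp only [List.forall_mem_cons, List.not_mem_nil, false_imp_iff, implies_true, and_true]
  simp (maxDischargeDepth := 8) only [FOFormula.Realize, child_xyz, child_yxz, child_zxy,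
    I.path, I.tree, I.root, I.nxt, I.update, hw, hx, hy, hz, Function.update_self,
    Function.update_of_ne hxz, Function.update_of_ne hyz, Function.update_of_ne hxy, forall_eq,
    exists_eq_left]
  constructor
  · rintro ⟨h1, h2, h3, h4, h5, h6, h7, h8, h9, h10, h11, h12, h13, h14⟩
    exact ⟨h1, h2, h3, h4, h5, h6, h7, h8, h9, h10, h11, h12, h13, h14⟩
  · rintro ⟨h1, h2, h3, h4, h5, h6, h7, h8, h9, h10, h11, h12, h13, h14⟩
    exact ⟨h1, h2, h3, h4, h5, h6, h7, h8, h9, h10, h11, h12, h13, h14⟩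

end Interprets
end PreLayering

/-! ### The sentence with one monadic variable -/

section OneSet
variable {V : Type*} {G : SimpleGraph V}

/-- `u` has at least seven neighbours in `X`. In a copy of `W_a` on `X`, this tells all path
vertices except the first two from the tree vertices, which have at most six neighbours. -/
def HasSevenNeighbors (G : SimpleGraph V) (X : Set V) (u : V) : Prop :=
  ∃ y : Fin 7 → V, Function.Injective y ∧ ∀ t, y t ∈ X ∧ G.Adj u (y t)

/-- The path of the copy of `W_a` on `X` whose first two path vertices are `p₀`, `p₁`. -/
def pathOf (G : SimpleGraph V) (X : Set V) (p₀ p₁ : V) : Set V :=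
  {u | u ∈ X ∧ (u = p₀ ∨ u = p₁ ∨ HasSevenNeighbors G X u)}

/-- The successor relation on the path `P` of a copy of `W_a` with tree `T`: some tree vertex on the
level of `u` has two distinct tree neighbours on the level of `v`. -/
def IsNext (G : SimpleGraph V) (P T : Set V) (u v : V) : Prop :=
  u ∈ P ∧ v ∈ P ∧ G.Adj u v ∧ ∃ t, t ∈ T ∧ G.Adj u t ∧ ∃ s, s ∈ T ∧ G.Adj t s ∧ G.Adj v s ∧
    ∃ s', s' ∈ T ∧ G.Adj t s' ∧ G.Adj v s' ∧ s ≠ s'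

/-! #### The formulas

The variables `0` and `1` stand for the first two path vertices, `2`, `3` and `4` are the variables
of `preLayeringFormula`, and the others are auxiliary. -/

/-- The variables for seven neighbours. -/
def degVars (t : Fin 7) : Fin 19 := ⟨t + 8, by omega⟩

/-- The variables for four children. -/
def childVars (t : Fin 4) : Fin 19 := ⟨t + 15, by omega⟩

/-- The formula saying that the variable `i` lies in `pathOf`. -/
def pathFormula (i : Fin 19) : FOFormula 1 19 :=
  .mem 0 i ⋏ (.eq i 0 ⋎ .eq i 1 ⋎ .exs (List.ofFn degVars) (.distinct degVars ⋏
    .conj ((List.finRange 7).map fun t => .mem 0 (degVars t) ⋏ .adj i (degVars t))))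

/-- The formula saying that the variable `i` lies in the tree. -/
def treeFormula (i : Fin 19) : FOFormula 1 19 := .mem 0 i ⋏ .neg (pathFormula i)

/-- The formula expressing `IsNext`. -/
def nextFormula (i j : Fin 19) : FOFormula 1 19 :=
  pathFormula i ⋏ pathFormula j ⋏ .adj i j ⋏ .ex 5 (treeFormula 5 ⋏ .adj i 5 ⋏
    .ex 6 (treeFormula 6 ⋏ .adj 5 6 ⋏ .adj j 6 ⋏
      .ex 7 (treeFormula 7 ⋏ .adj 5 7 ⋏ .adj j 7 ⋏ .neg (.eq 6 7))))

/-- The formula saying that each tree vertex which is not on the last level has four children. -/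
def fourChildrenFormula : FOFormula 1 19 :=
  .all 2 (treeFormula 2 ⟹ .ex 3 (.ex 4 (.adj 3 2 ⋏ nextFormula 3 4)) ⟹
    .exs (List.ofFn childVars) (.distinct childVars ⋏
      .all 3 (.iff (childFormula treeFormula nextFormula 2 3 4)
        (.disj ((List.finRange 4).map fun i => .eq (childVars i) 3)))))

/-- The first-order part of the sentence with one monadic variable. -/
def oneSetFormula : FOFormula 1 19 :=
  .ex 0 (.ex 1 (.mem 0 0 ⋏ .mem 0 1 ⋏
    preLayeringFormula pathFormula treeFormula (.eq · 0) nextFormula 2 3 4 ⋏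
    fourChildrenFormula ⋏
    .all 2 (.mem 0 2 ⋎ .ex 3 (.mem 0 3 ⋏ .adj 2 3))))

variable {S : Fin 1 → Set V} {w : Fin 19 → V} {i j : Fin 19}

theorem degVars_injective : Function.Injective degVars := fun s t h => by
  simpa [degVars, Fin.ext_iff] using h

theorem childVars_injective : Function.Injective childVars := fun s t h => by
  simpa [childVars, Fin.ext_iff] using h

theorem extend_degVars {y : Fin 7 → V} (hi : i < 8) : Function.extend degVars y w i = w i := by
  refine Function.extend_apply' _ _ _ ?_
  rintro ⟨t, rfl⟩
  exact absurd hi (not_lt.2 (Nat.le_add_left 8 t))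

theorem extend_childVars {y : Fin 4 → V} (hi : i < 15) :
    Function.extend childVars y w i = w i := by
  refine Function.extend_apply' _ _ _ ?_
  rintro ⟨t, rfl⟩
  exact absurd hi (not_lt.2 (Nat.le_add_left 15 t))

theorem realize_pathFormula (hi : i < 8) :
    (pathFormula i).Realize G S w ↔ w i ∈ pathOf G (S 0) (w 0) (w 1) := by
  simp only [pathFormula, FOFormula.Realize, FOFormula.realize_exs_ofFn degVars_injective,
    FOFormula.realize_distinct, FOFormula.realize_conj, List.mem_map, List.mem_finRange, true_and,
    forall_exists_index, forall_apply_eq_imp_iff, degVars_injective.extend_apply,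
    extend_degVars hi, pathOf, HasSevenNeighbors, Set.mem_ofPred_eq]

theorem realize_treeFormula (hi : i < 8) :
    (treeFormula i).Realize G S w ↔ w i ∈ S 0 \ pathOf G (S 0) (w 0) (w 1) := by
  simp only [treeFormula, FOFormula.Realize, realize_pathFormula hi, Set.mem_sdiff]

theorem realize_nextFormula (hi : i < 5) (hj : j < 5) :
    (nextFormula i j).Realize G S w ↔ IsNext G (pathOf G (S 0) (w 0) (w 1))
      (S 0 \ pathOf G (S 0) (w 0) (w 1)) (w i) (w j) := by
  have update_of_lt {l i : Fin 19} (hl : 5 ≤ l) (hi : i < 5) (w : Fin 19 → V) (b : V) :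
      Function.update w l b i = w i := Function.update_of_ne (hi.trans_le hl).ne _ _
  have lt_eight {i : Fin 19} (hi : i < 5) : i < 8 := hi.trans (by decide)
  simp only [nextFormula, IsNext, FOFormula.Realize, realize_pathFormula (lt_eight hi),
    realize_pathFormula (lt_eight hj), realize_treeFormula (by decide : (5 : Fin 19) < 8),
    realize_treeFormula (by decide : (6 : Fin 19) < 8),
    realize_treeFormula (by decide : (7 : Fin 19) < 8), Function.update_self, ne_eq, hi, hj,
    update_of_lt (le_refl 5), update_of_lt (by decide : (5 : Fin 19) ≤ 6),
    update_of_lt (by decide : (5 : Fin 19) ≤ 7), (by decide : (0 : Fin 19) < 5),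
    (by decide : (1 : Fin 19) < 5), Function.update_of_ne (by decide : (5 : Fin 19) ≠ 6),
    Function.update_of_ne (by decide : (5 : Fin 19) ≠ 7),
    Function.update_of_ne (by decide : (6 : Fin 19) ≠ 7)]

theorem interprets_oneSet (p₀ p₁ : V) : Interprets G S {w | w 0 = p₀ ∧ w 1 = p₁} {2, 3, 4}
    pathFormula treeFormula (.eq · 0) nextFormula (pathOf G (S 0) p₀ p₁)
    (S 0 \ pathOf G (S 0) p₀ p₁) p₀
    (IsNext G (pathOf G (S 0) p₀ p₁) (S 0 \ pathOf G (S 0) p₀ p₁)) := by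
  have hA : ∀ i ∈ ({2, 3, 4} : Set (Fin 19)), i < 5 ∧ i < 8 ∧ i ≠ 0 ∧ i ≠ 1 := by
    rintro i (rfl | rfl | rfl) <;> decide
  constructor
  · rintro w ⟨h0, h1⟩ i hi b
    obtain ⟨-, -, hi0, hi1⟩ := hA i hi
    exact ⟨(Function.update_of_ne hi0.symm _ _).trans h0,
      (Function.update_of_ne hi1.symm _ _).trans h1⟩
  · rintro w ⟨rfl, rfl⟩ i hi
    exact realize_pathFormula (hA i hi).2.1
  · rintro w ⟨rfl, rfl⟩ i hi
    exact realize_treeFormula (hA i hi).2.1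
  · rintro w ⟨rfl, rfl⟩ i -
    exact Iff.rfl
  · rintro w ⟨rfl, rfl⟩ i hi j hj
    exact realize_nextFormula (hA i hi).1 (hA j hj).1

theorem realize_fourChildrenFormula {P T : Set V} (hP : P = pathOf G (S 0) (w 0) (w 1))
    (hT : T = S 0 \ P) :
    fourChildrenFormula.Realize G S w ↔
      ∀ t, t ∈ T → (∃ u v, G.Adj u t ∧ IsNext G P T u v) →
        ∃ c : Fin 4 → V, Function.Injective c ∧
          ∀ s, IsChild G T (IsNext G P T) t s ↔ ∃ i, c i = s := by
  subst hP hT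
  have I := interprets_oneSet (G := G) (S := S) (w 0) (w 1)
  have h2 : (2 : Fin 19) ∈ ({2, 3, 4} : Set (Fin 19)) := by simp
  have h3 : (3 : Fin 19) ∈ ({2, 3, 4} : Set (Fin 19)) := by simp
  have h4 : (4 : Fin 19) ∈ ({2, 3, 4} : Set (Fin 19)) := by simp
  simp only [fourChildrenFormula, FOFormula.Realize, FOFormula.realize_disj,
    FOFormula.realize_exs_ofFn childVars_injective, FOFormula.realize_distinct,
    childVars_injective.extend_apply]
  refine forall_congr' fun t => ?_
  have update_mem := I.update w ⟨rfl, rfl⟩ 2 h2 t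
  rw [I.tree _ update_mem 2 h2, Function.update_self]
  refine imp_congr_right fun _ => imp_congr ?_ ?_
  · refine exists_congr fun u => exists_congr fun v => ?_
    rw [I.nxt _ (I.update _ (I.update _ update_mem 3 h3 u) 4 h4 v) 3 h3 4 h4]
    simp
  · refine exists_congr fun c => and_congr_right fun _ => forall_congr' fun s => ?_
    have extend_mem : Function.extend childVars c (Function.update w 2 t) ∈
        {w' | w' 0 = w 0 ∧ w' 1 = w 1} :=
      ⟨(extend_childVars (by decide)).trans update_mem.1,
        (extend_childVars (by decide)).trans update_mem.2⟩
    have childVars_ne (i : Fin 4) : childVars i ≠ 3 := by revert i; decide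
    rw [I.realize_child h2 h3 h4 (by decide) (by decide) (by decide)
      (I.update _ extend_mem 3 h3 s)]
    simp [extend_childVars, childVars_ne, childVars_injective.extend_apply, FOFormula.Realize]

theorem realize_oneSetFormula : oneSetFormula.Realize G S w ↔
    ∃ p₀ p₁, p₀ ∈ S 0 ∧ p₁ ∈ S 0 ∧
      IsLayering G (pathOf G (S 0) p₀ p₁) (S 0 \ pathOf G (S 0) p₀ p₁) p₀
        (IsNext G (pathOf G (S 0) p₀ p₁) (S 0 \ pathOf G (S 0) p₀ p₁)) ∧
      ∀ x, x ∈ S 0 ∨ ∃ y, y ∈ S 0 ∧ G.Adj x y := by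
  simp only [oneSetFormula, FOFormula.Realize]
  refine exists_congr fun p₀ => exists_congr fun p₁ => ?_
  have hw : Function.update (Function.update w 0 p₀) 1 p₁ ∈
      {w : Fin 19 → V | w 0 = p₀ ∧ w 1 = p₁} := by simp
  rw [(interprets_oneSet p₀ p₁).realize_preLayering (by simp) (by simp) (by simp) (by decide)
    (by decide) (by decide) hw, realize_fourChildrenFormula (by rw [hw.1, hw.2]) rfl]
  simp only [Function.update_self, Function.update_of_ne (by decide : (2 : Fin 19) ≠ 3),
    Function.update_of_ne (by decide : (0 : Fin 19) ≠ 1)]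
  exact ⟨fun ⟨h0, h1, hpre, hchildren, hdom⟩ => ⟨h0, h1, ⟨hpre, hchildren⟩, hdom⟩,
    fun ⟨h0, h1, h, hdom⟩ => ⟨h0, h1, h.toIsPreLayering, h.exists_children, hdom⟩⟩

/-! #### The set of vertices of a copy -/

theorem hasSevenNeighbors_range_iff {U : Type*} {H : SimpleGraph U} (f : H ↪g G) {u : U} :
    HasSevenNeighbors G (Set.range f) (f u) ↔ HasSevenNeighbors H Set.univ u := by
  constructor
  · rintro ⟨y, hy, hadj⟩
    choose z hz using fun t => (hadj t).1
    obtain rfl : f ∘ z = y := funext hz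
    exact ⟨z, hy.of_comp, fun t => ⟨trivial, f.map_adj_iff.1 (hadj t).2⟩⟩
  · rintro ⟨y, hy, hadj⟩
    exact ⟨f ∘ y, f.injective.comp hy, fun t => ⟨⟨_, rfl⟩, f.map_adj_iff.2 (hadj t).2⟩⟩

variable {a : ℕ+}

theorem not_hasSevenNeighbors_inr (w : Word a) :
    ¬ HasSevenNeighbors (graphW a) Set.univ (.inr w) := by
  rintro ⟨y, hy, hadj⟩
  -- The neighbours of `w` are a path vertex, at most one parent and at most four children.
  let code : VertexW a → Option (Option (Fin 4)) := Sum.elim (fun _ => none) fun v =>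
    some (if v.1.length < w.1.length then none else v.1.head?)
  have code_inj : Set.InjOn code {u | (graphW a).Adj (.inr w) u} := by
    rintro (i | v) hu (j | v') hu' heq
    · simp only [Set.mem_ofPred_eq, graphW_adj_inr_inl] at hu hu'
      rw [Fin.ext (hu.trans hu'.symm)]
    · cases heq
    · cases heq
    · simp only [Set.mem_ofPred_eq, graphW_adj_inr_inr] at hu hu'
      suffices v.1 = v'.1 from congrArg Sum.inr (Subtype.ext this)
      rcases hu with ⟨c, hc⟩ | ⟨c, hc⟩ <;> rcases hu' with ⟨d, hd⟩ | ⟨d, hd⟩ <;>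
        simp_all [code]
  have hcard := Fintype.card_le_of_injective (fun t => code (y t)) fun s t hst =>
    hy (code_inj (hadj s).2 (hadj t).2 hst)
  simp at hcard

theorem hasSevenNeighbors_inl {i : Fin (a : ℕ)} (hi : 2 ≤ (i : ℕ)) :
    HasSevenNeighbors (graphW a) Set.univ (.inl i) := by
  let word (t : Fin 7) : List (Fin 4) :=
    Fin.ofNat 4 (t / 4) :: Fin.ofNat 4 t :: List.replicate (i - 2) 0
  have length_word (t : Fin 7) : (word t).length = i := by
    simp only [word, List.length_cons, List.length_replicate]
    omega
  refine ⟨fun t => .inr ⟨word t, (length_word t).trans_lt i.2⟩, fun s t hst => ?_,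
    fun t => ⟨trivial, graphW_adj_inl_inr.2 (length_word t).symm⟩⟩
  simp only [word, Sum.inr.injEq, Subtype.mk.injEq, List.cons.injEq, and_true, Fin.ext_iff,
    Fin.ofNat] at hst ⊢
  omega

/-- The second vertex on the path of a copy of `W_a`, or the first one if there is no second. -/
def copySecond (f : graphW a ↪g G) : V := f (.inl ⟨min 1 (a - 1), by have := a.pos; omega⟩)

variable (f : graphW a ↪g G)

theorem pathOf_copy :
    pathOf G (Set.range f) (copyRoot f) (copySecond f) = copyPath f := by
  ext x
  constructor
  · rintro ⟨⟨i | w, rfl⟩, h⟩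
    · exact ⟨i, rfl⟩
    · rw [hasSevenNeighbors_range_iff] at h
      rcases h with h | h | h
      · exact absurd (f.injective h) Sum.inr_ne_inl
      · exact absurd (f.injective h) Sum.inr_ne_inl
      · exact absurd h (not_hasSevenNeighbors_inr w)
  · rintro ⟨i, rfl⟩
    refine ⟨⟨_, rfl⟩, ?_⟩
    dsimp only
    rw [hasSevenNeighbors_range_iff, copyRoot, copySecond, f.injective.eq_iff,
      f.injective.eq_iff, Sum.inl.injEq, Sum.inl.injEq, Fin.ext_iff, Fin.ext_iff]
    by_cases hi : 2 ≤ (i : ℕ)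
    · exact Or.inr (Or.inr (hasSevenNeighbors_inl hi))
    · dsimp only
      omega

theorem isNext_copy : IsNext G (copyPath f) (copyTree f) = copyNxt f := by
  ext x y
  constructor
  · rintro ⟨⟨i, rfl⟩, ⟨j, rfl⟩, hij, _, ⟨t, rfl⟩, hit, _, ⟨s, rfl⟩, hts, hjs, _, ⟨s', rfl⟩, hts',
      hjs', hne⟩
    rw [copyNxt_iff]
    simp only [f.map_adj_iff, graphW_adj_inl_inl, graphW_adj_inl_inr, graphW_adj_inr_inr]
      at hij hit hts hjs hts' hjs'
    refine hij.resolve_right fun hji => hne ?_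
    have eq_tail (s : Word a) (hs : (j : ℕ) = s.1.length)
        (hts : (∃ c, s.1 = c :: t.1) ∨ ∃ c, t.1 = c :: s.1) : s.1 = t.1.tail := by
      rcases hts with ⟨c, hc⟩ | ⟨c, hc⟩
      · rw [hc, List.length_cons] at hs
        omega
      · rw [hc, List.tail_cons]
    rw [show s = s' from Subtype.ext ((eq_tail s hjs hts).trans (eq_tail s' hjs' hts').symm)]
  · rintro ⟨i, j, hij, rfl, rfl⟩
    have child_lt (c : Fin 4) : (c :: List.replicate i 0).length < (a : ℕ) := by
      rw [List.length_cons, List.length_replicate, hij]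
      exact j.2
    refine ⟨⟨i, rfl⟩, ⟨j, rfl⟩, by simp [hij], _, ⟨⟨List.replicate i 0, by simp⟩, rfl⟩, by simp,
      _, ⟨⟨_, child_lt 0⟩, rfl⟩, by simp, by simp [hij],
      _, ⟨⟨_, child_lt 1⟩, rfl⟩, by simp, by simp [hij], fun h => ?_⟩
    simpa using f.injective h

theorem oneSet_models_iff [Finite V] [Nonempty V] (G : SimpleGraph V) :
    oneSetFormula.toSentence.Models G ↔ ∃ a : ℕ+, HasInducedDominatingCopy (graphW a) G := by
  rw [FOFormula.models_toSentence fun S v => realize_oneSetFormula]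
  constructor
  · rintro ⟨S, p₀, p₁, -, -, h, hdom⟩
    refine h.exists_hasInducedDominatingCopy ?_
    rwa [Set.union_sdiff_cancel fun x hx => hx.1]
  · rintro ⟨a, h⟩
    obtain ⟨f, hdom⟩ := hasInducedDominatingCopy_iff.1 h
    refine ⟨fun _ => Set.range f, copyRoot f, copySecond f, ⟨_, rfl⟩, ⟨_, rfl⟩, ?_, hdom⟩
    have range_sdiff : Set.range f \ copyPath f = copyTree f := by
      rw [range_copy, Set.union_sdiff_left, (disjoint_copyPath_copyTree f).symm.sdiff_eq_left]
    rw [pathOf_copy, range_sdiff, isNext_copy]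
    exact isLayering_copy f

end OneSet

/-! ### The sentence with three first-order variables

The monadic variables `0`, `1`, `2` are the residue classes modulo three of the path, `3` is the
tree, `4` contains just the first vertex of the path, and `5`, …, `8` number the children. -/

section ThreeVariables
/-- The formula saying that a variable lies on the path. -/
def pathFormula₃ (i : Fin 3) : FOFormula 9 3 := .mem 0 i ⋎ .mem 1 i ⋎ .mem 2 i

/-- The formula saying that the second variable follows the first one on the path. -/
def nextFormula₃ (i j : Fin 3) : FOFormula 9 3 :=
  .adj i j ⋏ (.mem 0 i ⋏ .mem 1 j ⋎ .mem 1 i ⋏ .mem 2 j ⋎ .mem 2 i ⋏ .mem 0 j)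

/-- The monadic variable for the children with number `c`. -/
def childSet (c : Fin 4) : Fin 9 := Fin.natAdd 5 c

/-- The formula expressing `NumbersChildren`. -/
def fourChildrenFormula₃ : FOFormula 9 3 :=
  .all 0 (.conj ((List.finRange 4).map fun c => .conj (((List.finRange 4).filter (c ≠ ·)).map
    fun d => .neg (.mem (childSet c) 0 ⋏ .mem (childSet d) 0)))) ⋏
  .all 0 (.all 1 (childFormula (.mem 3) nextFormula₃ 0 1 2 ⟹
    .disj ((List.finRange 4).map fun c => .mem (childSet c) 1))) ⋏
  .conj ((List.finRange 4).map fun c => .all 0 (.all 1 (.all 2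
    (childFormula (.mem 3) nextFormula₃ 0 1 2 ⟹ childFormula (.mem 3) nextFormula₃ 0 2 1 ⟹
      .mem (childSet c) 1 ⟹ .mem (childSet c) 2 ⟹ .eq 1 2)))) ⋏
  .conj ((List.finRange 4).map fun c => .all 0 (.mem 3 0 ⟹
    .ex 1 (.ex 2 (.adj 1 0 ⋏ nextFormula₃ 1 2)) ⟹
      .ex 1 (.mem (childSet c) 1 ⋏ childFormula (.mem 3) nextFormula₃ 0 1 2)))

/-- The first-order part of the sentence with three first-order variables. -/
def threeVariableFormula : FOFormula 9 3 :=
  .ex 0 (.mem 4 0) ⋏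
  .all 0 (.all 1 (.mem 4 0 ⟹ .mem 4 1 ⟹ .eq 0 1)) ⋏
  preLayeringFormula pathFormula₃ (.mem 3) (.mem 4) nextFormula₃ 0 1 2 ⋏
  fourChildrenFormula₃ ⋏
  .all 0 ((pathFormula₃ 0 ⋎ .mem 3 0) ⋎ .ex 1 ((pathFormula₃ 1 ⋎ .mem 3 1) ⋏ .adj 0 1))

variable {V : Type*}

/-- The successor relation defined by `nextFormula₃`. -/
def IsNextMod (G : SimpleGraph V) (S : Fin 9 → Set V) (u v : V) : Prop :=
  G.Adj u v ∧ (u ∈ S 0 ∧ v ∈ S 1 ∨ u ∈ S 1 ∧ v ∈ S 2 ∨ u ∈ S 2 ∧ v ∈ S 0)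

/-- The sets `D 0, …, D 3` number the children of every tree vertex, and each tree vertex that is
not on the last level has a child of every number. -/
structure NumbersChildren (G : SimpleGraph V) (T : Set V) (nxt : V → V → Prop)
    (D : Fin 4 → Set V) : Prop where
  not_mem_both : ∀ x c d, c ≠ d → ¬(x ∈ D c ∧ x ∈ D d)
  exists_number : ∀ t s, IsChild G T nxt t s → ∃ c, s ∈ D c
  child_unique : ∀ c t s s', IsChild G T nxt t s → IsChild G T nxt t s' →
    s ∈ D c → s' ∈ D c → s = s'
  exists_child : ∀ c t, t ∈ T → (∃ u v, G.Adj u t ∧ nxt u v) → ∃ s, s ∈ D c ∧ IsChild G T nxt t s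

variable {G : SimpleGraph V} {S : Fin 9 → Set V} {v : Fin 3 → V} {r : V}

theorem NumbersChildren.isLayering {P T : Set V} {nxt : V → V → Prop} {D : Fin 4 → Set V}
    (hD : NumbersChildren G T nxt D) (h : IsPreLayering G P T r nxt) : IsLayering G P T r nxt where
  toIsPreLayering := h
  exists_children t ht htu := by
    choose c hcD hc using fun i => hD.exists_child i t ht htu
    refine ⟨c, fun i j hij => ?_, fun s => ⟨fun hs => ?_, ?_⟩⟩
    · exact by_contra fun hne => hD.not_mem_both (c i) i j hne ⟨hcD i, hij ▸ hcD j⟩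
    · obtain ⟨i, hi⟩ := hD.exists_number t s hs
      exact ⟨i, hD.child_unique i t _ _ (hc i) hs (hcD i) hi⟩
    · rintro ⟨i, rfl⟩
      exact hc i

theorem interprets_threeVariables (hr : S 4 = {r}) :
    Interprets G S Set.univ Set.univ pathFormula₃ (.mem 3) (.mem 4) nextFormula₃
      (S 0 ∪ (S 1 ∪ S 2)) (S 3) r (IsNextMod G S) where
  update := by simp
  path _ _ _ _ := Iff.rfl
  tree _ _ _ _ := Iff.rfl
  root _ _ _ _ := by rw [FOFormula.Realize, hr, Set.mem_singleton_iff]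
  nxt _ _ _ _ _ _ := Iff.rfl

theorem realize_fourChildrenFormula₃ (hr : S 4 = {r}) : fourChildrenFormula₃.Realize G S v ↔
    NumbersChildren G (S 3) (IsNextMod G S) fun c => S (childSet c) := by
  have I := interprets_threeVariables (G := G) hr
  have child_012 := fun w => I.realize_child (x := 0) (y := 1) (z := 2) trivial trivial trivial
    (by decide) (by decide) (by decide) (w := w) trivial
  have child_021 := fun w => I.realize_child (x := 0) (y := 2) (z := 1) trivial trivial trivial
    (by decide) (by decide) (by decide) (w := w) trivial
  have next_12 := fun w => I.nxt w trivial 1 trivial 2 trivial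
  simp only [fourChildrenFormula₃, FOFormula.Realize, FOFormula.realize_conj,
    FOFormula.realize_disj, List.mem_map, List.mem_finRange, true_and, forall_exists_index,
    exists_exists_eq_and, forall_apply_eq_imp_iff, List.mem_filter, decide_eq_true_eq, and_imp,
    forall_apply_eq_imp_iff₂, child_012, child_021, next_12, Function.update_self,
    Function.update_of_ne (by decide : (0 : Fin 3) ≠ 1),
    Function.update_of_ne (by decide : (0 : Fin 3) ≠ 2),
    Function.update_of_ne (by decide : (1 : Fin 3) ≠ 2)]
  refine ⟨fun ⟨hdisj, hnum, huniq, hex⟩ => ⟨hdisj, hnum, huniq, ?_⟩,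
    fun h => ⟨h.not_mem_both, h.exists_number, h.child_unique, ?_⟩⟩
  · exact fun c t ht ⟨u, v, hut, huv⟩ => hex c t ht u v hut huv
  · exact fun c t ht u v hut huv => h.exists_child c t ht ⟨u, v, hut, huv⟩

theorem realize_threeVariableFormula : threeVariableFormula.Realize G S v ↔
    ∃ r, S 4 = {r} ∧ IsPreLayering G (S 0 ∪ (S 1 ∪ S 2)) (S 3) r (IsNextMod G S) ∧
      NumbersChildren G (S 3) (IsNextMod G S) (fun c => S (childSet c)) ∧
      ∀ x, x ∈ (S 0 ∪ (S 1 ∪ S 2)) ∪ S 3 ∨ ∃ y, y ∈ (S 0 ∪ (S 1 ∪ S 2)) ∪ S 3 ∧ G.Adj x y := by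
  have realize_preLayering (r) (hr : S 4 = {r}) :=
    (interprets_threeVariables (G := G) hr).realize_preLayering (x := 0) (y := 1) (z := 2)
      trivial trivial trivial (by decide) (by decide) (by decide) (w := v) trivial
  constructor
  · rintro ⟨⟨r, hr⟩, huniq, hpre, hfour, hdom⟩
    have hr' : S 4 = {r} := Set.eq_singleton_iff_unique_mem.2 ⟨hr, fun x hx => huniq x r hx hr⟩
    exact ⟨r, hr', (realize_preLayering r hr').1 hpre, (realize_fourChildrenFormula₃ hr').1 hfour,
      hdom⟩
  · rintro ⟨r, hr, hpre, hnum, hdom⟩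
    obtain ⟨hmem, huniq⟩ := Set.eq_singleton_iff_unique_mem.1 hr
    exact ⟨⟨r, hmem⟩, fun x y hx hy => (huniq x hx).trans (huniq y hy).symm,
      (realize_preLayering r hr).2 hpre, (realize_fourChildrenFormula₃ hr).2 hnum, hdom⟩

section CopySets
variable {a : ℕ+}

/-- The path vertices of a copy of `W_a` with index congruent to `s` modulo three. -/
def copyResidue (f : graphW a ↪g G) (s : ℕ) : Set V :=
  {x | ∃ i : Fin (a : ℕ), (i : ℕ) % 3 = s ∧ f (.inl i) = x}

/-- The tree vertices of a copy of `W_a` whose word starts with the letter `c`. -/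
def copyChildren (f : graphW a ↪g G) (c : Fin 4) : Set V :=
  {x | ∃ w : Word a, (∃ u, w.1 = c :: u) ∧ f (.inr w) = x}

/-- The monadic variables describing a copy of `W_a`. -/
def copySets (f : graphW a ↪g G) : Fin 9 → Set V :=
  Fin.append ![copyResidue f 0, copyResidue f 1, copyResidue f 2, copyTree f, {copyRoot f}]
    (copyChildren f)

variable (f : graphW a ↪g G)

theorem copySets_childSet (c : Fin 4) : copySets f (childSet c) = copyChildren f c :=
  Fin.append_right _ _ c

theorem copyResidue_union :
    copyResidue f 0 ∪ (copyResidue f 1 ∪ copyResidue f 2) = copyPath f := by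
  ext x
  simp only [copyResidue, copyPath, Set.mem_union, Set.mem_ofPred_eq, Set.mem_range, ← exists_or,
    ← or_and_right]
  exact exists_congr fun i => and_iff_right (by omega)

theorem isNextMod_copySets : IsNextMod G (copySets f) = copyNxt f := by
  ext x y
  change G.Adj x y ∧ (x ∈ copyResidue f 0 ∧ y ∈ copyResidue f 1 ∨
    x ∈ copyResidue f 1 ∧ y ∈ copyResidue f 2 ∨ x ∈ copyResidue f 2 ∧ y ∈ copyResidue f 0) ↔ _
  constructor
  · rintro ⟨hadj, ⟨⟨i, hi, rfl⟩, j, hj, rfl⟩ | ⟨⟨i, hi, rfl⟩, j, hj, rfl⟩ |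
      ⟨⟨i, hi, rfl⟩, j, hj, rfl⟩⟩ <;>
    · rw [f.map_adj_iff, graphW_adj_inl_inl] at hadj
      rw [copyNxt_iff]
      omega
  · rintro ⟨i, j, hij, rfl, rfl⟩
    have hmod : (i : ℕ) % 3 = 0 ∧ (j : ℕ) % 3 = 1 ∨ (i : ℕ) % 3 = 1 ∧ (j : ℕ) % 3 = 2 ∨
      (i : ℕ) % 3 = 2 ∧ (j : ℕ) % 3 = 0 := by omega
    have mem {s t : ℕ} (h : (i : ℕ) % 3 = s ∧ (j : ℕ) % 3 = t) :
        f (.inl i) ∈ copyResidue f s ∧ f (.inl j) ∈ copyResidue f t :=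
      ⟨⟨i, h.1, rfl⟩, j, h.2, rfl⟩
    exact ⟨by simp [hij], hmod.imp mem (Or.imp mem mem)⟩

theorem numbersChildren_copy :
    NumbersChildren G (copyTree f) (copyNxt f) (copyChildren f) where
  not_mem_both := by
    rintro _ c d hcd ⟨⟨w, ⟨u, hw⟩, rfl⟩, w', ⟨u', hw'⟩, h⟩
    obtain rfl : w' = w := Sum.inr_injective (f.injective h)
    rw [hw, List.cons.injEq] at hw'
    exact hcd hw'.1
  exists_number := by
    rintro _ s ⟨⟨w, rfl⟩, hs⟩
    obtain ⟨c, hc, rfl⟩ := isChild_copy_iff.1 ⟨⟨w, rfl⟩, hs⟩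
    exact ⟨c, _, ⟨_, rfl⟩, rfl⟩
  child_unique := by
    rintro c _ s s' ⟨⟨w, rfl⟩, hs⟩ hs' ⟨x, ⟨u, hx⟩, rfl⟩ ⟨y, ⟨u', hy⟩, rfl⟩
    obtain ⟨d, hd, hxd⟩ := isChild_copy_iff.1 ⟨⟨w, rfl⟩, hs⟩
    obtain ⟨e, he, hye⟩ := isChild_copy_iff.1 hs'
    obtain rfl := Sum.inr_injective (f.injective hxd)
    obtain rfl := Sum.inr_injective (f.injective hye)
    obtain rfl := (List.cons.inj hx).1
    obtain rfl := (List.cons.inj hy).1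
    rfl
  exists_child := by
    rintro c _ ⟨w, rfl⟩ ⟨_, _, hadj, i, j, hij, rfl, rfl⟩
    rw [f.map_adj_iff, graphW_adj_inl_inr] at hadj
    have hlen : (c :: w.1).length < (a : ℕ) := by
      rw [List.length_cons]
      omega
    exact ⟨_, ⟨_, ⟨_, rfl⟩, rfl⟩, isChild_copy_iff.2 ⟨c, hlen, rfl⟩⟩

end CopySets

theorem threeVariables_models_iff [Finite V] [Nonempty V] (G : SimpleGraph V) :
    threeVariableFormula.toSentence.Models G ↔
      ∃ a : ℕ+, HasInducedDominatingCopy (graphW a) G := by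
  rw [FOFormula.models_toSentence fun S v => realize_threeVariableFormula]
  constructor
  · rintro ⟨S, r, -, hpre, hnum, hdom⟩
    exact (hnum.isLayering hpre).exists_hasInducedDominatingCopy hdom
  · rintro ⟨a, h⟩
    obtain ⟨f, hdom⟩ := hasInducedDominatingCopy_iff.1 h
    have path_eq : copySets f 0 ∪ (copySets f 1 ∪ copySets f 2) = copyPath f := copyResidue_union f
    have tree_eq : copySets f 3 = copyTree f := rfl
    refine ⟨copySets f, copyRoot f, rfl, ?_⟩
    simp only [path_eq, tree_eq, isNextMod_copySets, copySets_childSet, ← range_copy]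
    exact ⟨isPreLayering_copy f, numbersChildren_copy f, hdom⟩

end ThreeVariables

open MeasureTheory ProbabilityTheory

/-! ### The second moment method and independent events -/

section Probability
variable {Ω ι : Type*}

theorem sq_sum_indicator_sub_mul_indicator (s : Finset ι) (A : ι → Set Ω) (t : ℝ) (ω : Ω) :
    (∑ i ∈ s, (A i).indicator 1 ω - t * (⋃ i ∈ s, A i).indicator 1 ω) ^ 2 =
      t * t * (⋃ i ∈ s, A i).indicator 1 ω - 2 * t * ∑ i ∈ s, (A i).indicator 1 ω +
        ∑ x ∈ s ×ˢ s, (A x.1 ∩ A x.2).indicator 1 ω := by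
  simp only [Finset.sum_product, Set.inter_indicator_one, Pi.mul_apply, ← Finset.sum_mul_sum]
  by_cases hω : ω ∈ ⋃ i ∈ s, A i
  · rw [Set.indicator_of_mem hω, Pi.one_apply]
    ring
  · have sum_eq_zero : ∑ i ∈ s, (A i).indicator (1 : Ω → ℝ) ω = 0 := Finset.sum_eq_zero fun i hi =>
      Set.indicator_of_notMem (fun h => hω (Set.mem_biUnion hi h)) _
    simp [sum_eq_zero, hω]

variable [MeasurableSpace Ω] {μ : Measure Ω}

theorem integrable_sum_indicator_one [IsFiniteMeasure μ] (s : Finset ι) {A : ι → Set Ω}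
    (hA : ∀ i ∈ s, MeasurableSet (A i)) :
    Integrable (fun ω => ∑ i ∈ s, (A i).indicator (1 : Ω → ℝ) ω) μ :=
  integrable_finsetSum s fun i hi => (integrable_const (1 : ℝ)).indicator (hA i hi)

theorem integral_sum_indicator_one [IsFiniteMeasure μ] (s : Finset ι) {A : ι → Set Ω}
    (hA : ∀ i ∈ s, MeasurableSet (A i)) :
    ∫ ω, ∑ i ∈ s, (A i).indicator (1 : Ω → ℝ) ω ∂μ = ∑ i ∈ s, μ.real (A i) := by
  have int_indicator : ∀ i ∈ s, Integrable ((A i).indicator (1 : Ω → ℝ)) μ :=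
    fun i hi => (integrable_const (1 : ℝ)).indicator (hA i hi)
  rw [integral_finsetSum s int_indicator]
  exact Finset.sum_congr rfl fun i hi => integral_indicator_one (hA i hi)

/-- The Chung–Erdős inequality. -/
theorem sq_sum_measureReal_le [IsFiniteMeasure μ] (s : Finset ι) {A : ι → Set Ω}
    (hA : ∀ i ∈ s, MeasurableSet (A i)) :
    (∑ i ∈ s, μ.real (A i)) ^ 2 ≤
      μ.real (⋃ i ∈ s, A i) * ∑ i ∈ s, ∑ j ∈ s, μ.real (A i ∩ A j) := by
  have hU := s.measurableSet_biUnion hA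
  have hAA : ∀ x ∈ s ×ˢ s, MeasurableSet (A x.1 ∩ A x.2) := fun x hx =>
    (hA x.1 (Finset.mem_product.1 hx).1).inter (hA x.2 (Finset.mem_product.1 hx).2)
  have quadratic_nonneg : ∀ t : ℝ, 0 ≤ μ.real (⋃ i ∈ s, A i) * (t * t) +
      -2 * (∑ i ∈ s, μ.real (A i)) * t + ∑ i ∈ s, ∑ j ∈ s, μ.real (A i ∩ A j) := by
    intro t
    have h : 0 ≤ ∫ ω, (∑ i ∈ s, (A i).indicator (1 : Ω → ℝ) ω -
        t * (⋃ i ∈ s, A i).indicator 1 ω) ^ 2 ∂μ := integral_nonneg fun ω => sq_nonneg _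
    have int_union : Integrable (fun ω => t * t * (⋃ i ∈ s, A i).indicator (1 : Ω → ℝ) ω) μ :=
      ((integrable_const (1 : ℝ)).indicator hU).const_mul _
    have int_sum := (integrable_sum_indicator_one (μ := μ) s hA).const_mul (2 * t)
    have int_diff : Integrable (fun ω => t * t * (⋃ i ∈ s, A i).indicator (1 : Ω → ℝ) ω -
        2 * t * ∑ i ∈ s, (A i).indicator 1 ω) μ := int_union.sub int_sum
    simp only [sq_sum_indicator_sub_mul_indicator] at h
    rw [integral_add int_diff (integrable_sum_indicator_one (s ×ˢ s) hAA),
      integral_sub int_union int_sum, integral_const_mul, integral_const_mul,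
      integral_indicator_one hU, integral_sum_indicator_one s hA,
      integral_sum_indicator_one (s ×ˢ s) hAA, Finset.sum_product] at h
    linarith
  have h := discrim_le_zero quadratic_nonneg
  rw [discrim] at h
  linarith

theorem measureReal_biInter_compl_of_iIndepSet {A : ι → Set Ω} (hA : iIndepSet A μ)
    (hm : ∀ i, MeasurableSet (A i)) (s : Finset ι) :
    μ.real (⋂ i ∈ s, (A i)ᶜ) = ∏ i ∈ s, (1 - μ.real (A i)) := by
  have := hA.isProbabilityMeasure
  have h := (iIndepSet_iff A μ).1 hA s (f := fun i => (A i)ᶜ)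
    fun i _ => (MeasurableSpace.measurableSet_generateFrom (Set.mem_singleton _)).compl
  rw [measureReal_def, h, ENNReal.toReal_prod]
  exact Finset.prod_congr rfl fun i _ => probReal_compl_eq_one_sub (hm i)

end Probability

/-! ### Prescribed edges in the binomial random graph -/

section BinomialRandom
variable {V : Type*}

instance [Finite V] : DiscreteMeasurableSpace (SimpleGraph V) := by
  have : MeasurableSingletonClass (SimpleGraph V) := ⟨fun G => by
    have : ({G} : Set (SimpleGraph V)) = SimpleGraph.edgeSet ⁻¹' {G.edgeSet} := by
      ext G'
      simp
    rw [this]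
    exact SimpleGraph.measurable_edgeSet (measurableSet_singleton _)⟩
  infer_instance

/-- The event that the edges of the random graph among the pairs in `E` are those in `s`. -/
def prescribedEvent (E : Finset (Sym2 V)) (s : Set (Sym2 V)) : Set (SimpleGraph V) :=
  {G | ∀ e ∈ E, e ∈ G.edgeSet ↔ e ∈ s}

open scoped Classical in
/-- The probability that the pair `e` is an edge exactly if it lies in `s`, when edges have
probability `p`. -/
noncomputable def pairWeight (s : Set (Sym2 V)) (p : unitInterval) (e : Sym2 V) : ℝ :=
  if e ∈ s then (p : ℝ) else 1 - p

variable {E : Finset (Sym2 V)} {s : Set (Sym2 V)} {p : unitInterval}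

theorem pairWeight_of_mem {e : Sym2 V} (he : e ∈ s) : pairWeight s p e = p := if_pos he

theorem pairWeight_of_notMem {e : Sym2 V} (he : e ∉ s) : pairWeight s p e = 1 - p := if_neg he

theorem pairWeight_nonneg (e : Sym2 V) : 0 ≤ pairWeight s p e := by
  rw [pairWeight]
  split_ifs
  exacts [p.2.1, sub_nonneg.2 p.2.2]

theorem pairWeight_pos (hp0 : 0 < p) (hp1 : p < 1) (e : Sym2 V) : 0 < pairWeight s p e := by
  rw [pairWeight]
  split_ifs
  exacts [hp0, sub_pos.2 hp1]

theorem pairWeight_map {U : Type*} {f : U → V} (hf : Function.Injective f) (s : Set (Sym2 U))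
    (e : Sym2 U) : pairWeight (Sym2.map f '' s) p (e.map f) = pairWeight s p e := by
  classical exact if_congr (Sym2.map.injective hf).mem_set_image rfl rfl

theorem prod_pairWeight (E : Finset (Sym2 V)) (s : Set (Sym2 V)) [DecidablePred (· ∈ s)] :
    ∏ e ∈ E, pairWeight s p e =
      (p : ℝ) ^ (E.filter (· ∈ s)).card * (1 - p : ℝ) ^ (E.filter (· ∉ s)).card := by
  rw [← Finset.prod_filter_mul_prod_filter_not E (· ∈ s),
    Finset.prod_eq_pow_card fun e he => pairWeight_of_mem (Finset.mem_filter.1 he).2,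
    Finset.prod_eq_pow_card fun e he => pairWeight_of_notMem (Finset.mem_filter.1 he).2]

theorem measureReal_prescribedEvent [Finite V] (hE : ∀ e ∈ E, ¬e.IsDiag) (s : Set (Sym2 V)) :
    (SimpleGraph.binomialRandom V p).real (prescribedEvent E s) = ∏ e ∈ E, pairWeight s p e := by
  have hm : Measurable fun q : Sym2 V → Prop => {i | q i} := MeasurableEquiv.setOfPred.measurable
  rw [measureReal_def, SimpleGraph.binomialRandom_eq_map, setBernoulli_eq_map,
    Measure.map_apply (by fun_prop) (.of_discrete), Measure.map_apply hm (.of_discrete)]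
  have preimage_eq : (fun q : Sym2 V → Prop => {i | q i}) ⁻¹' (SimpleGraph.fromEdgeSet ⁻¹'
      prescribedEvent E s) = Set.pi E fun e => {b | b ↔ e ∈ s} := by
    ext q
    simp only [prescribedEvent, Set.mem_preimage, Set.mem_ofPred_eq, Set.mem_pi, Finset.mem_coe,
      SimpleGraph.edgeSet_fromEdgeSet]
    exact forall₂_congr fun e he => by simp [hE e he]
  rw [preimage_eq, Measure.infinitePi_pi _ fun _ _ => .of_discrete, ENNReal.toReal_prod]
  refine Finset.prod_congr rfl fun e he => ?_
  by_cases h : e ∈ s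
  · simp [pairWeight_of_mem h, h, hE e he, Set.indicator]
  · simp [pairWeight_of_notMem h, h, hE e he, Set.indicator]

theorem prescribedEvent_congr {s' : Set (Sym2 V)} (h : ∀ e ∈ E, e ∈ s ↔ e ∈ s') :
    prescribedEvent E s = prescribedEvent E s' :=
  Set.ext fun _ => forall₂_congr fun e he => by rw [h e he]

theorem iIndepSet_prescribedEvent [Finite V] {ι : Type*} {E : ι → Finset (Sym2 V)}
    (hE : ∀ i, ∀ e ∈ E i, ¬e.IsDiag) (hdisj : Pairwise (Function.onFun Disjoint E))
    (s : ι → Set (Sym2 V)) :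
    iIndepSet (fun i => prescribedEvent (E i) (s i)) (SimpleGraph.binomialRandom V p) := by
  classical
  set s' : Set (Sym2 V) := {e | ∃ i, e ∈ E i ∧ e ∈ s i}
  have mem_s' : ∀ i, ∀ e ∈ E i, (e ∈ s i ↔ e ∈ s') := by
    refine fun i e he => ⟨fun h => ⟨i, he, h⟩, ?_⟩
    rintro ⟨j, hj, h⟩
    obtain rfl : i = j := by
      by_contra hij
      exact Finset.disjoint_left.1 (hdisj hij) he hj
    exact h
  simp only [fun i => prescribedEvent_congr (mem_s' i)]
  refine (iIndepSet_iff_meas_biInter fun i => .of_discrete).2 fun t => ?_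
  have biInter_eq : ⋂ i ∈ t, prescribedEvent (E i) s' = prescribedEvent (t.biUnion E) s' := by
    ext G
    simp only [prescribedEvent, Set.mem_iInter, Set.mem_ofPred_eq, Finset.mem_biUnion]
    exact ⟨fun h e ⟨i, hi, he⟩ => h i hi e he, fun h i hi e he => h e ⟨i, hi, he⟩⟩
  have hbiUnion : ∀ e ∈ t.biUnion E, ¬e.IsDiag := fun e he => by
    obtain ⟨i, -, he⟩ := Finset.mem_biUnion.1 he
    exact hE i e he
  rw [← ENNReal.toReal_eq_toReal_iff' (measure_ne_top _ _)
    (ENNReal.prod_ne_top fun i _ => measure_ne_top _ _), ENNReal.toReal_prod, biInter_eq]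
  simp only [← measureReal_def, measureReal_prescribedEvent hbiUnion,
    fun i => measureReal_prescribedEvent (p := p) (hE i) s']
  exact Finset.prod_biUnion fun i _ j _ hij => hdisj hij

theorem measureReal_prescribedEvent_inter [Finite V] {E₁ E₂ : Finset (Sym2 V)}
    (h₁ : ∀ e ∈ E₁, ¬e.IsDiag) (h₂ : ∀ e ∈ E₂, ¬e.IsDiag) (hdisj : Disjoint E₁ E₂)
    (s₁ s₂ : Set (Sym2 V)) :
    (SimpleGraph.binomialRandom V p).real (prescribedEvent E₁ s₁ ∩ prescribedEvent E₂ s₂) =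
      (∏ e ∈ E₁, pairWeight s₁ p e) * ∏ e ∈ E₂, pairWeight s₂ p e := by
  have h := (iIndepSet_prescribedEvent (p := p) (E := fun b => bif b then E₁ else E₂)
    (by rintro (_ | _); exacts [h₂, h₁]) (pairwise_on_bool.2 hdisj)
    fun b => bif b then s₁ else s₂).meas_biInter Finset.univ
  rw [← measureReal_prescribedEvent h₁, ← measureReal_prescribedEvent h₂, measureReal_def,
    measureReal_def, measureReal_def, ← ENNReal.toReal_mul]
  simp only [Finset.mem_univ, Set.iInter_true, Fintype.prod_bool, cond_true, cond_false] at h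
  rw [← h, Set.inter_eq_iInter]
  congr 2
  exact Set.iInter_congr fun b => by cases b <;> rfl

end BinomialRandom

/-! ### Pairs of vertices and sparse graphs -/

section Pairs
variable {U V : Type*}

open scoped Classical in
/-- The pairs of distinct elements of `I`. -/
noncomputable def pairs (I : Finset U) : Finset (Sym2 U) := I.offDiag.image Sym2.mk.uncurry

theorem mk_mem_pairs {I : Finset U} {x y : U} : s(x, y) ∈ pairs I ↔ x ∈ I ∧ y ∈ I ∧ x ≠ y := by
  simp only [pairs, Finset.mem_image, Finset.mem_offDiag, Prod.exists, Function.uncurry_apply_pair,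
    Sym2.eq_iff]
  constructor
  · rintro ⟨a, b, ⟨ha, hb, hab⟩, ⟨rfl, rfl⟩ | ⟨rfl, rfl⟩⟩
    · exact ⟨ha, hb, hab⟩
    · exact ⟨hb, ha, hab.symm⟩
  · exact fun h => ⟨x, y, h, Or.inl ⟨rfl, rfl⟩⟩

theorem not_isDiag_of_mem_pairs {I : Finset U} {e : Sym2 U} (he : e ∈ pairs I) : ¬e.IsDiag := by
  induction e with
  | _ x y => exact (mk_mem_pairs.1 he).2.2

theorem two_mul_card_pairs (I : Finset U) : 2 * (pairs I).card = I.card * (I.card - 1) := by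
  classical
  rw [pairs, Sym2.two_mul_card_image_offDiag, Finset.offDiag_card, Nat.mul_sub_one]

open scoped Classical in
theorem pairs_inter (I J : Finset U) : pairs I ∩ pairs J = pairs (I ∩ J) := by
  ext e
  induction e with
  | _ x y =>
    simp only [Finset.mem_inter, mk_mem_pairs]
    tauto

open scoped Classical in
theorem pairs_image {f : U → V} (hf : Function.Injective f) (I : Finset U) :
    pairs (I.image f) = (pairs I).image (Sym2.map f) := by
  ext e
  constructor
  · induction e with
    | _ x y =>
      rw [mk_mem_pairs, Finset.mem_image, Finset.mem_image]
      rintro ⟨⟨u, hu, rfl⟩, ⟨v, hv, rfl⟩, huv⟩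
      exact Finset.mem_image_of_mem (Sym2.map f)
        (mk_mem_pairs.2 ⟨hu, hv, fun h => huv (congrArg f h)⟩)
  · rw [Finset.mem_image]
    rintro ⟨e, he, rfl⟩
    induction e with
    | _ u v =>
      obtain ⟨hu, hv, huv⟩ := mk_mem_pairs.1 he
      exact mk_mem_pairs.2
        ⟨Finset.mem_image_of_mem f hu, Finset.mem_image_of_mem f hv, hf.ne huv⟩

/-- The pairs formed by `v` and the elements of `T`. -/
noncomputable def starPairs (v : V) (T : Finset V) : Finset (Sym2 V) :=
  T.map ⟨fun u => s(v, u), fun _ _ => Sym2.congr_right.1⟩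

theorem mem_starPairs {v : V} {T : Finset V} {e : Sym2 V} :
    e ∈ starPairs v T ↔ ∃ u ∈ T, s(v, u) = e :=
  Finset.mem_map

theorem card_starPairs (v : V) (T : Finset V) : (starPairs v T).card = T.card :=
  Finset.card_map _

theorem not_isDiag_of_mem_starPairs {v : V} {T : Finset V} (hv : v ∉ T) {e : Sym2 V}
    (he : e ∈ starPairs v T) : ¬e.IsDiag := by
  obtain ⟨u, hu, rfl⟩ := mem_starPairs.1 he
  exact fun h => hv (Sym2.mk_isDiag_iff.1 h ▸ hu)

theorem disjoint_pairs_starPairs {v : V} {T : Finset V} (hv : v ∉ T) :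
    Disjoint (pairs T) (starPairs v T) := by
  rw [Finset.disjoint_left]
  intro e he he'
  obtain ⟨u, -, rfl⟩ := mem_starPairs.1 he'
  exact hv (mk_mem_pairs.1 he).1

theorem disjoint_starPairs {v w : V} {T : Finset V} (hv : v ∉ T) (hvw : v ≠ w) :
    Disjoint (starPairs v T) (starPairs w T) := by
  rw [Finset.disjoint_left]
  intro e he he'
  obtain ⟨u, -, rfl⟩ := mem_starPairs.1 he
  obtain ⟨u', hu', h⟩ := mem_starPairs.1 he'
  rcases Sym2.eq_iff.1 h with ⟨h, -⟩ | ⟨-, rfl⟩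
  · exact hvw h.symm
  · exact hv hu'

end Pairs

section Orientation
variable {U : Type*} {H : SimpleGraph U} {d : ℕ} {p : unitInterval}

/-- The edges of `H` can be oriented with out-degrees at most `d`; `o 0 u, …, o (d - 1) u` include
the out-neighbours of `u`. -/
def HasOrientation (H : SimpleGraph U) (d : ℕ) : Prop :=
  ∃ o : Fin d → U → U, ∀ u v, H.Adj u v → ∃ j, v = o j u ∨ u = o j v

-- Path vertices point to their predecessor, tree vertices to their parent and to the path vertex
-- on their level.
theorem hasOrientation_graphW (a : ℕ+) : HasOrientation (graphW a) 2 := by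
  refine ⟨fun j => Sum.elim (fun i => .inl ⟨i - 1, by omega⟩) fun w => if j = 0 then
    .inr ⟨w.1.tail, by have := w.2; simp only [List.length_tail]; omega⟩
    else .inl ⟨w.1.length, w.2⟩, ?_⟩
  rintro (⟨i, hi⟩ | ⟨w, hw⟩) (⟨j, hj⟩ | ⟨w', hw'⟩) h
  · simp only [graphW_adj_inl_inl] at h
    refine ⟨0, ?_⟩
    simp only [Sum.elim_inl, Sum.inl.injEq, Fin.mk.injEq]
    omega
  · simp only [graphW_adj_inl_inr] at h
    exact ⟨1, Or.inr (by simp [h])⟩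
  · simp only [graphW_adj_inr_inl] at h
    exact ⟨1, Or.inl (by simp [h])⟩
  · simp only [graphW_adj_inr_inr] at h
    refine ⟨0, ?_⟩
    rcases h with ⟨c, rfl⟩ | ⟨c, rfl⟩ <;> simp

theorem HasOrientation.card_filter_pairs_le [DecidablePred (· ∈ H.edgeSet)]
    (hH : HasOrientation H d) (I : Finset U) :
    ((pairs I).filter (· ∈ H.edgeSet)).card ≤ d * I.card := by
  classical
  obtain ⟨o, ho⟩ := hH
  have subset_image : (pairs I).filter (· ∈ H.edgeSet) ⊆
      ((Finset.univ : Finset (Fin d)) ×ˢ I).image fun x => s(x.2, o x.1 x.2) := by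
    intro e he
    rw [Finset.mem_filter] at he
    induction e with
    | _ u v =>
      rw [mk_mem_pairs, SimpleGraph.mem_edgeSet] at he
      obtain ⟨j, hj | hj⟩ := ho u v he.2
      · exact Finset.mem_image.2 ⟨(j, u), by simp [he.1.1], by rw [hj]⟩
      · exact Finset.mem_image.2 ⟨(j, v), by simp [he.1.2.1], by rw [hj, Sym2.eq_swap]⟩
  calc _ ≤ _ := Finset.card_le_card subset_image
    _ ≤ _ := Finset.card_image_le
    _ = d * I.card := by rw [Finset.card_product, Finset.card_fin]

theorem HasOrientation.le_prod_pairWeight (hH : HasOrientation H d) (I : Finset U) :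
    (1 - p : ℝ) ^ (pairs I).card * (p : ℝ) ^ (d * I.card) ≤
      ∏ e ∈ pairs I, pairWeight H.edgeSet p e := by
  classical
  have hq0 : (0 : ℝ) ≤ 1 - p := sub_nonneg.2 p.2.2
  have hq1 : (1 - p : ℝ) ≤ 1 := sub_le_self _ p.2.1
  rw [prod_pairWeight, mul_comm]
  exact mul_le_mul
    (pow_le_pow_of_le_one p.2.1 p.2.2 (hH.card_filter_pairs_le I))
    (pow_le_pow_of_le_one hq0 hq1 (Finset.card_filter_le _ _)) (pow_nonneg hq0 _)
    (pow_nonneg p.2.1 _)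

theorem HasOrientation.prod_pairWeight_mul_le (hH : HasOrientation H d) (I : Finset U) :
    (∏ e ∈ pairs I, pairWeight H.edgeSet p e) * (1 - p : ℝ) ^ (d * I.card) ≤
      (1 - p : ℝ) ^ (pairs I).card := by
  classical
  have hq0 : (0 : ℝ) ≤ 1 - p := sub_nonneg.2 p.2.2
  have hq1 : (1 - p : ℝ) ≤ 1 := sub_le_self _ p.2.1
  rw [prod_pairWeight, mul_comm,
    ← Finset.card_filter_add_card_filter_not (s := pairs I) (· ∈ H.edgeSet), pow_add]
  exact mul_le_mul (pow_le_pow_of_le_one hq0 hq1 (hH.card_filter_pairs_le I))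
    (mul_le_of_le_one_left (pow_nonneg hq0 _) (pow_le_one₀ p.2.1 p.2.2))
    (mul_nonneg (pow_nonneg p.2.1 _) (pow_nonneg hq0 _)) (pow_nonneg hq0 _)

end Orientation

/-! ### Copies of a fixed graph in the binomial random graph -/

section Copies
variable {U V : Type*} {H : SimpleGraph U} {p : unitInterval} {f g : U → V}

/-- The event that `f`, if injective, is an induced copy of `H`. -/
def copyEvent (H : SimpleGraph U) (f : U → V) : Set (SimpleGraph V) :=
  {G | ∀ u v, G.Adj (f u) (f v) ↔ H.Adj u v}

/-- The probability that a given injection is an induced copy of `H`. -/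
noncomputable def copyProb [Fintype U] (H : SimpleGraph U) (p : unitInterval) : ℝ :=
  ∏ e ∈ pairs Finset.univ, pairWeight H.edgeSet p e

theorem copyProb_nonneg [Fintype U] : 0 ≤ copyProb H p :=
  Finset.prod_nonneg fun e _ => pairWeight_nonneg e

theorem copyProb_pos [Fintype U] (hp0 : 0 < p) (hp1 : p < 1) : 0 < copyProb H p :=
  Finset.prod_pos fun e _ => pairWeight_pos hp0 hp1 e

open scoped Classical in
theorem copyEvent_eq_prescribedEvent [Fintype U] (hf : Function.Injective f) :
    copyEvent H f =
      prescribedEvent (pairs (Finset.univ.image f)) (Sym2.map f '' H.edgeSet) := by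
  have mem_image_iff : ∀ e, e.map f ∈ Sym2.map f '' H.edgeSet ↔ e ∈ H.edgeSet := fun e =>
    (Sym2.map.injective hf).mem_set_image
  ext G
  rw [pairs_image hf, prescribedEvent, Set.mem_ofPred_eq, Finset.forall_mem_image]
  simp only [mem_image_iff]
  constructor
  · intro h e _
    induction e with
    | _ u v => exact h u v
  · intro h u v
    rcases eq_or_ne u v with rfl | huv
    · simp
    · exact h (mk_mem_pairs.2 ⟨Finset.mem_univ u, Finset.mem_univ v, huv⟩)

open scoped Classical in
theorem prod_pairs_image (hf : Function.Injective f) (I : Finset U) (s : Set (Sym2 U)) :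
    ∏ e ∈ pairs (I.image f), pairWeight (Sym2.map f '' s) p e =
      ∏ e ∈ pairs I, pairWeight s p e := by
  rw [pairs_image hf, Finset.prod_image (Sym2.map.injective hf).injOn]
  exact Finset.prod_congr rfl fun e _ => pairWeight_map hf s e

theorem measureReal_copyEvent [Fintype U] [Finite V] (hf : Function.Injective f) :
    (SimpleGraph.binomialRandom V p).real (copyEvent H f) = copyProb H p := by
  classical
  rw [copyEvent_eq_prescribedEvent hf,
    measureReal_prescribedEvent fun _ => not_isDiag_of_mem_pairs, prod_pairs_image hf, copyProb]

theorem setOf_isolated_eq_prescribedEvent (v : V) (T : Finset V) :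
    {G : SimpleGraph V | ∀ u ∈ T, ¬G.Adj v u} = prescribedEvent (starPairs v T) ∅ := by
  ext G
  simp [prescribedEvent, mem_starPairs]

theorem prod_starPairs (v : V) (T : Finset V) :
    ∏ e ∈ starPairs v T, pairWeight ∅ p e = (1 - p : ℝ) ^ T.card := by
  rw [Finset.prod_eq_pow_card fun e _ => pairWeight_of_notMem (Set.notMem_empty e),
    card_starPairs]

theorem measureReal_copyEvent_inter_isolated [Fintype U] [Finite V] (hf : Function.Injective f)
    {v : V} (hv : v ∉ Set.range f) :
    (SimpleGraph.binomialRandom V p).real (copyEvent H f ∩ {G | ∀ u, ¬G.Adj v (f u)}) =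
      copyProb H p * (1 - p : ℝ) ^ Fintype.card U := by
  classical
  have hv' : v ∉ Finset.univ.image f := by simpa using hv
  have isolated_eq : {G : SimpleGraph V | ∀ u, ¬G.Adj v (f u)} =
      prescribedEvent (starPairs v (Finset.univ.image f)) ∅ := by
    rw [← setOf_isolated_eq_prescribedEvent]
    simp
  rw [isolated_eq, copyEvent_eq_prescribedEvent hf,
    measureReal_prescribedEvent_inter (fun _ => not_isDiag_of_mem_pairs)
      (fun _ => not_isDiag_of_mem_starPairs hv') (disjoint_pairs_starPairs hv'),
    prod_pairs_image hf, prod_starPairs, Finset.card_image_of_injective _ hf, Finset.card_univ,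
    copyProb]

open scoped Classical in
theorem measureReal_copyEvent_inter_mul_le [Fintype U] [Finite V] (hf : Function.Injective f)
    (hg : Function.Injective g) :
    (SimpleGraph.binomialRandom V p).real (copyEvent H f ∩ copyEvent H g) *
        ∏ e ∈ pairs (Finset.univ.filter fun u => g u ∈ Set.range f), pairWeight H.edgeSet p e ≤
      copyProb H p ^ 2 := by
  set A := Finset.univ.image f
  set B := Finset.univ.image g
  set I := Finset.univ.filter fun u => g u ∈ Set.range f
  have image_I : pairs B ∩ pairs A = pairs (I.image g) := by
    rw [pairs_inter]
    congr 1
    ext v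
    simp only [A, B, I, Finset.mem_inter, Finset.mem_image, Finset.mem_filter, Finset.mem_univ,
      true_and, Set.mem_range]
    aesop
  have le_prod : (SimpleGraph.binomialRandom V p).real (copyEvent H f ∩ copyEvent H g) ≤
      copyProb H p * ∏ e ∈ pairs B \ pairs A, pairWeight (Sym2.map g '' H.edgeSet) p e := by
    rw [copyProb, ← prod_pairs_image hf, ← measureReal_prescribedEvent_inter
      (fun _ => not_isDiag_of_mem_pairs)
      (fun _ he => not_isDiag_of_mem_pairs (Finset.mem_sdiff.1 he).1) Finset.disjoint_sdiff,
      copyEvent_eq_prescribedEvent hf, copyEvent_eq_prescribedEvent hg]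
    exact measureReal_mono (Set.inter_subset_inter_right _ fun G hG e he =>
      hG e (Finset.mem_sdiff.1 he).1)
  calc _ ≤ copyProb H p * (∏ e ∈ pairs B \ pairs A, pairWeight (Sym2.map g '' H.edgeSet) p e) *
        ∏ e ∈ pairs I, pairWeight H.edgeSet p e :=
      mul_le_mul_of_nonneg_right le_prod (Finset.prod_nonneg fun e _ => pairWeight_nonneg e)
    _ = copyProb H p ^ 2 := by
      rw [← prod_pairs_image hg I, ← image_I, mul_assoc, mul_comm (∏ e ∈ _, _),
        Finset.prod_inter_mul_prod_sdiff, prod_pairs_image hg, sq, copyProb]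

/-- The factor by which each common vertex of two copies of a graph with `N` vertices and an
orientation with out-degrees at most `d` increases the probability that both are present. -/
noncomputable def overlapFactor (p : unitInterval) (d N : ℕ) : ℝ :=
  (√(1 - p : ℝ) ^ N * (p : ℝ) ^ d)⁻¹

theorem one_le_overlapFactor (hp0 : 0 < p) (hp1 : p < 1) (d N : ℕ) : 1 ≤ overlapFactor p d N := by
  have hp0' : (0 : ℝ) < p := hp0
  have sqrt_pos : 0 < √(1 - p : ℝ) := Real.sqrt_pos.2 (sub_pos.2 hp1)
  have sqrt_le_one : √(1 - p : ℝ) ≤ 1 := Real.sqrt_le_one.2 (sub_le_self _ hp0'.le)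
  exact (one_le_inv₀ (by positivity)).2 (mul_le_one₀ (pow_le_one₀ sqrt_pos.le sqrt_le_one)
    (by positivity) (pow_le_one₀ hp0'.le p.2.2))

theorem inv_overlapFactor_pow_le [Fintype U] {d : ℕ} (hH : HasOrientation H d)
    (I : Finset U) :
    (overlapFactor p d (Fintype.card U))⁻¹ ^ I.card ≤
      ∏ e ∈ pairs I, pairWeight H.edgeSet p e := by
  refine le_trans ?_ (hH.le_prod_pairWeight I)
  rw [overlapFactor, inv_inv, mul_pow, ← pow_mul, ← pow_mul]
  refine mul_le_mul_of_nonneg_right ?_ (pow_nonneg p.2.1 _)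
  calc √(1 - p : ℝ) ^ (Fintype.card U * I.card)
      ≤ √(1 - p : ℝ) ^ (2 * (pairs I).card) := by
        refine pow_le_pow_of_le_one (Real.sqrt_nonneg _)
          (Real.sqrt_le_one.2 (sub_le_self _ p.2.1)) ?_
        rw [two_mul_card_pairs, mul_comm]
        exact Nat.mul_le_mul_right _ ((Nat.sub_le _ _).trans (Finset.card_le_univ I))
    _ = (1 - p : ℝ) ^ (pairs I).card := by rw [pow_mul, Real.sq_sqrt (sub_nonneg.2 p.2.2)]

open scoped Classical in
theorem measureReal_copyEvent_inter_le [Fintype U] [Finite V] {d : ℕ} (hH : HasOrientation H d)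
    (hp0 : 0 < p) (hp1 : p < 1) (hf : Function.Injective f) (hg : Function.Injective g) :
    (SimpleGraph.binomialRandom V p).real (copyEvent H f ∩ copyEvent H g) ≤
      copyProb H p ^ 2 *
        ∏ u, if g u ∈ Set.range f then overlapFactor p d (Fintype.card U) else 1 := by
  have factor_pos : 0 < overlapFactor p d (Fintype.card U) :=
    one_pos.trans_le (one_le_overlapFactor hp0 hp1 d _)
  rw [Finset.prod_ite, Finset.prod_const, Finset.prod_const_one, mul_one, ← div_le_iff₀
    (by positivity), div_eq_mul_inv, ← inv_pow]
  exact (mul_le_mul_of_nonneg_left (inv_overlapFactor_pow_le hH _) measureReal_nonneg).trans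
    (measureReal_copyEvent_inter_mul_le hf hg)

end Copies

/-! ### Bounds for the probability of a dominating copy -/

section Domination
variable {V : Type*} {p : unitInterval}

/-- The event that every vertex outside `T` has a neighbour in `T`. -/
def dominatingEvent (T : Set V) : Set (SimpleGraph V) :=
  {G | ∀ v ∉ T, ∃ u ∈ T, G.Adj v u}

theorem measureReal_dominatingEvent [Fintype V] (T : Finset V) :
    (SimpleGraph.binomialRandom V p).real (dominatingEvent T) =
      (1 - (1 - p : ℝ) ^ T.card) ^ (Fintype.card V - T.card) := by
  classical
  have indep : iIndepSet (fun v : {v // v ∉ T} => prescribedEvent (starPairs v.1 T) ∅)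
      (SimpleGraph.binomialRandom V p) :=
    iIndepSet_prescribedEvent (fun v _ => not_isDiag_of_mem_starPairs v.2)
      (fun v w hvw => disjoint_starPairs v.2 (Subtype.coe_ne_coe.2 hvw)) _
  have measureReal_isolated : ∀ v : {v // v ∉ T}, (SimpleGraph.binomialRandom V p).real
      (prescribedEvent (starPairs v.1 T) ∅) = (1 - p : ℝ) ^ T.card := fun v => by
    rw [measureReal_prescribedEvent fun _ => not_isDiag_of_mem_starPairs v.2, prod_starPairs]
  have dominatingEvent_eq : dominatingEvent (T : Set V) =
      ⋂ v ∈ (Finset.univ : Finset {v // v ∉ T}), (prescribedEvent (starPairs v.1 T) ∅)ᶜ := by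
    ext G
    simp [dominatingEvent, ← setOf_isolated_eq_prescribedEvent]
  rw [dominatingEvent_eq, measureReal_biInter_compl_of_iIndepSet indep fun _ => .of_discrete,
    Finset.prod_eq_pow_card fun v _ => by rw [measureReal_isolated], Finset.card_univ,
    Fintype.card_subtype_compl, Fintype.card_coe]

theorem exists_range_eq_of_card_le {T : Finset V} (hT : T.Nonempty) {M : ℕ} (hM : T.card ≤ M) :
    ∃ h : Fin M → V, Set.range h = T := by
  have := hT.to_subtype
  obtain ⟨e⟩ := Function.Embedding.nonempty_of_card_le (α := T) (β := Fin M) (by simpa using hM)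
  refine ⟨Subtype.val ∘ Function.invFun e, ?_⟩
  rw [(Function.invFun_surjective e.injective).range_comp, Subtype.range_coe]

theorem measureReal_exists_dominating_le [Fintype V] (M : ℕ) :
    (SimpleGraph.binomialRandom V p).real
        {G | ∃ T : Finset V, T.Nonempty ∧ T.card ≤ M ∧ G ∈ dominatingEvent T} ≤
      (Fintype.card V : ℝ) ^ M * (1 - (1 - p : ℝ) ^ M) ^ (Fintype.card V - M) := by
  classical
  have hq0 : (0 : ℝ) ≤ 1 - p := sub_nonneg.2 p.2.2
  have hq1 : (1 - p : ℝ) ≤ 1 := sub_le_self _ p.2.1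
  have subset_iUnion : {G : SimpleGraph V | ∃ T : Finset V, T.Nonempty ∧ T.card ≤ M ∧
      G ∈ dominatingEvent T} ⊆ ⋃ h : Fin M → V, dominatingEvent (Set.range h) := by
    rintro G ⟨T, hT, hM, hG⟩
    obtain ⟨h, hh⟩ := exists_range_eq_of_card_le hT hM
    exact Set.mem_iUnion.2 ⟨h, hh ▸ hG⟩
  have measureReal_le : ∀ h : Fin M → V,
      (SimpleGraph.binomialRandom V p).real (dominatingEvent (Set.range h)) ≤
        (1 - (1 - p : ℝ) ^ M) ^ (Fintype.card V - M) := by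
    intro h
    have card_le : (Finset.univ.image h).card ≤ M :=
      Finset.card_image_le.trans_eq (Finset.card_fin M)
    rw [show Set.range h = (Finset.univ.image h : Finset V) by simp, measureReal_dominatingEvent]
    have pow_le := pow_le_pow_of_le_one hq0 hq1 card_le
    have pow_le_one := pow_le_one₀ hq0 hq1 (n := (Finset.univ.image h).card)
    have pow_nonneg := pow_nonneg hq0 M
    calc _ ≤ (1 - (1 - p : ℝ) ^ M) ^ (Fintype.card V - (Finset.univ.image h).card) :=
          pow_le_pow_left₀ (by linarith) (by linarith) _
      _ ≤ _ := pow_le_pow_of_le_one (by linarith) (by linarith) (Nat.sub_le_sub_left card_le _)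
  calc _ ≤ ∑ h : Fin M → V, (SimpleGraph.binomialRandom V p).real (dominatingEvent (Set.range h)) :=
        (measureReal_mono subset_iUnion).trans (measureReal_iUnion_fintype_le _)
    _ ≤ _ := Finset.sum_le_card_nsmul _ _ _ fun h _ => measureReal_le h
    _ = _ := by simp

end Domination

section Moments
variable {U V : Type*} [Fintype U] [Fintype V] {H : SimpleGraph U} {p : unitInterval} {d : ℕ}

theorem le_measureReal_copyEvent_inter_dominatingEvent {f : U → V} (hf : Function.Injective f) :
    copyProb H p * (1 - Fintype.card V * (1 - p : ℝ) ^ Fintype.card U) ≤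
      (SimpleGraph.binomialRandom V p).real (copyEvent H f ∩ dominatingEvent (Set.range f)) := by
  classical
  set μ := SimpleGraph.binomialRandom V p
  set W := Finset.univ.filter (· ∉ Set.range f)
  have subset_union : copyEvent H f ⊆ (copyEvent H f ∩ dominatingEvent (Set.range f)) ∪
      ⋃ v ∈ W, copyEvent H f ∩ {G | ∀ u, ¬G.Adj v (f u)} := by
    intro G hG
    by_cases hd : G ∈ dominatingEvent (Set.range f)
    · exact Or.inl ⟨hG, hd⟩
    · simp only [dominatingEvent, Set.mem_ofPred_eq, Set.exists_range_iff, not_forall,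
        not_exists] at hd
      obtain ⟨v, hv, hd⟩ := hd
      exact Or.inr (Set.mem_biUnion (by simpa [W] using hv) ⟨hG, hd⟩)
  have isolated_le : μ.real (⋃ v ∈ W, copyEvent H f ∩ {G | ∀ u, ¬G.Adj v (f u)}) ≤
      Fintype.card V * (copyProb H p * (1 - p : ℝ) ^ Fintype.card U) := by
    refine (measureReal_biUnion_finset_le _ _).trans ?_
    rw [Finset.sum_eq_card_nsmul fun v hv => measureReal_copyEvent_inter_isolated hf
      (Finset.mem_filter.1 hv).2, nsmul_eq_mul]
    have hq : (0 : ℝ) ≤ 1 - p := sub_nonneg.2 p.2.2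
    exact mul_le_mul_of_nonneg_right (mod_cast Finset.card_le_univ W)
      (mul_nonneg copyProb_nonneg (pow_nonneg hq _))
  have union_le := (measureReal_mono (μ := μ) subset_union).trans (measureReal_union_le _ _)
  rw [measureReal_copyEvent hf] at union_le
  linarith

open scoped Classical in
theorem sum_prod_ite_range {f : U → V} (hf : Function.Injective f) (y : ℝ) :
    ∑ g : U → V, ∏ u, (if g u ∈ Set.range f then y else 1) =
      (Fintype.card V + Fintype.card U * (y - 1)) ^ Fintype.card U := by
  have card_range : (Finset.univ.filter (· ∈ Set.range f)).card = Fintype.card U := by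
    rw [← Finset.card_univ, ← Finset.card_image_of_injective _ hf]
    congr 1
    ext v
    simp
  have sum_eq : ∑ v, (if v ∈ Set.range f then y else (1 : ℝ)) =
      Fintype.card V + Fintype.card U * (y - 1) := by
    have ite_eq : ∀ v, (if v ∈ Set.range f then y else (1 : ℝ)) =
        1 + if v ∈ Set.range f then y - 1 else 0 := fun v => by split_ifs <;> ring
    simp only [ite_eq]
    rw [Finset.sum_add_distrib, ← Finset.sum_filter, Finset.sum_const, Finset.sum_const, card_range]
    simp
  rw [← Fintype.piFinset_univ, ← Finset.prod_univ_sum (fun _ : U => (Finset.univ : Finset V))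
    fun (_ : U) v => if v ∈ Set.range f then y else (1 : ℝ), Finset.prod_const, Finset.card_univ,
    sum_eq]

open scoped Classical in
theorem sum_measureReal_copyEvent_inter_le (hH : HasOrientation H d) (hp0 : 0 < p) (hp1 : p < 1)
    (f : U ↪ V) :
    ∑ g : U ↪ V, (SimpleGraph.binomialRandom V p).real (copyEvent H f ∩ copyEvent H g) ≤
      copyProb H p ^ 2 * (Fintype.card V +
        Fintype.card U * (overlapFactor p d (Fintype.card U) - 1)) ^ Fintype.card U := by
  set y := overlapFactor p d (Fintype.card U)
  have factor_pos : 0 < y := one_pos.trans_le (one_le_overlapFactor hp0 hp1 d _)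
  calc _ ≤ ∑ g : U ↪ V, copyProb H p ^ 2 * ∏ u, (if g u ∈ Set.range f then y else 1) :=
        Finset.sum_le_sum fun g _ =>
          measureReal_copyEvent_inter_le hH hp0 hp1 f.injective g.injective
    _ = ∑ g ∈ Finset.univ.map ⟨fun g : U ↪ V => (g : U → V), DFunLike.coe_injective⟩,
          copyProb H p ^ 2 * ∏ u, (if g u ∈ Set.range f then y else 1) := by
        rw [Finset.sum_map]
        rfl
    _ ≤ ∑ g : U → V, copyProb H p ^ 2 * ∏ u, (if g u ∈ Set.range f then y else 1) := by
        refine Finset.sum_le_sum_of_subset_of_nonneg (Finset.subset_univ _) fun g _ _ =>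
          mul_nonneg (sq_nonneg _) (Finset.prod_nonneg fun u _ => ?_)
        split_ifs
        exacts [factor_pos.le, zero_le_one]
    _ = _ := by rw [← Finset.mul_sum, sum_prod_ite_range f.injective]

theorem copyEvent_inter_dominatingEvent_subset {U V : Type*} {H : SimpleGraph U} (f : U ↪ V) :
    copyEvent H f ∩ dominatingEvent (Set.range f) ⊆ {G | HasInducedDominatingCopy H G} :=
  fun _ hG => ⟨⟨f, fun {u v} => hG.1 u v⟩, fun v hv => Set.exists_range_iff.1 (hG.2 v hv)⟩

theorem sq_mul_descFactorial_le (hH : HasOrientation H d) (hp0 : 0 < p) (hp1 : p < 1)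
    (hdom : Fintype.card V * (1 - p : ℝ) ^ Fintype.card U ≤ 1)
    (hcard : Fintype.card U ≤ Fintype.card V) :
    (1 - Fintype.card V * (1 - p : ℝ) ^ Fintype.card U) ^ 2 *
        (Fintype.card V).descFactorial (Fintype.card U) ≤
      (SimpleGraph.binomialRandom V p).real {G | HasInducedDominatingCopy H G} *
        (Fintype.card V + Fintype.card U * (overlapFactor p d (Fintype.card U) - 1)) ^
          Fintype.card U := by
  classical
  set μ := SimpleGraph.binomialRandom V p
  set P := copyProb H p
  set δ := 1 - Fintype.card V * (1 - p : ℝ) ^ Fintype.card U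
  set D : ℝ := ((Fintype.card V).descFactorial (Fintype.card U) : ℝ)
  set K : ℝ := (Fintype.card V + Fintype.card U * (overlapFactor p d (Fintype.card U) - 1)) ^
    Fintype.card U
  set A : (U ↪ V) → Set (SimpleGraph V) := fun f => copyEvent H f ∩ dominatingEvent (Set.range f)
  have hP : 0 < P := copyProb_pos hp0 hp1
  have : 0 ≤ δ := sub_nonneg.2 hdom
  have hD : 0 < D := Nat.cast_pos.2 (Nat.descFactorial_pos.2 hcard)
  have card_embedding : ((Finset.univ : Finset (U ↪ V)).card : ℝ) = D := by
    rw [Finset.card_univ, Fintype.card_embedding_eq]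
  have first_moment : D * (P * δ) ≤ ∑ f, μ.real (A f) := by
    rw [← card_embedding, ← nsmul_eq_mul]
    exact Finset.card_nsmul_le_sum _ _ _ fun f _ =>
      le_measureReal_copyEvent_inter_dominatingEvent f.injective
  have second_moment : ∑ f, ∑ g, μ.real (A f ∩ A g) ≤ D * (P ^ 2 * K) := by
    rw [← card_embedding, ← nsmul_eq_mul]
    refine Finset.sum_le_card_nsmul _ _ _ fun f _ => ?_
    exact (Finset.sum_le_sum fun g _ => measureReal_mono (Set.inter_subset_inter
      Set.inter_subset_left Set.inter_subset_left)).trans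
      (sum_measureReal_copyEvent_inter_le hH hp0 hp1 f)
  have iUnion_subset : ⋃ f ∈ Finset.univ, A f ⊆ {G | HasInducedDominatingCopy H G} :=
    Set.iUnion₂_subset fun f _ => copyEvent_inter_dominatingEvent_subset f
  have chung_erdos : (D * (P * δ)) ^ 2 ≤
      μ.real {G | HasInducedDominatingCopy H G} * (D * (P ^ 2 * K)) :=
    (pow_le_pow_left₀ (by positivity) first_moment 2).trans <|
      (sq_sum_measureReal_le Finset.univ fun f _ => .of_discrete).trans <|
      mul_le_mul (measureReal_mono iUnion_subset) second_moment
        (Finset.sum_nonneg fun f _ => Finset.sum_nonneg fun g _ => measureReal_nonneg)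
        measureReal_nonneg
  refine le_of_mul_le_mul_left (a := D * P ^ 2) ?_ (by positivity)
  linarith

theorem one_sub_mul_pow_le_descFactorial {n N : ℕ} {y : ℝ} (hn : 0 < n) (hy : 1 ≤ y)
    (hN : N * y ≤ n) :
    (1 - N ^ 2 * y / n) * (n + N * (y - 1)) ^ N ≤ n.descFactorial N := by
  have hn' : (0 : ℝ) < n := Nat.cast_pos.2 hn
  have hN0 : (0 : ℝ) ≤ N := N.cast_nonneg
  have hNn : (N : ℝ) ≤ n := (le_mul_of_one_le_right hN0 hy).trans hN
  have hx : N * y / n ≤ 1 := (div_le_one hn').2 hN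
  have base_nonneg : (0 : ℝ) ≤ n + N * (y - 1) := by nlinarith
  have bernoulli : 1 - N ^ 2 * y / n ≤ (1 + -(N * y / n)) ^ N :=
    calc 1 - N ^ 2 * y / n = 1 + N * -(N * y / n) := by ring
      _ ≤ _ := one_add_mul_le_pow (by linarith) N
  have base_mul_le : (1 + -(N * y / n)) * (n + N * (y - 1)) ≤ n + 1 - N :=
    calc (1 + -(N * y / n)) * (n + N * (y - 1)) = n - N - N * y / n * (N * (y - 1)) := by
          field_simp
          ring
      _ ≤ n - N := sub_le_self _ (by have := sub_nonneg.2 hy; positivity)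
      _ ≤ n + 1 - N := by linarith
  calc _ ≤ (1 + -(N * y / n)) ^ N * (n + N * (y - 1)) ^ N := by gcongr
    _ = ((1 + -(N * y / n)) * (n + N * (y - 1))) ^ N := (mul_pow _ _ _).symm
    _ ≤ (n + 1 - N) ^ N := pow_le_pow_left₀ (mul_nonneg (by linarith) base_nonneg) base_mul_le _
    _ = ((n + 1 - N : ℕ) : ℝ) ^ N := by
        rw [Nat.cast_sub (Nat.le_succ_of_le (mod_cast hNn)), Nat.cast_add_one]
    _ ≤ _ := mod_cast Nat.pow_sub_le_descFactorial n N

theorem le_measureReal_hasInducedDominatingCopy (hH : HasOrientation H d) (hp0 : 0 < p)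
    (hp1 : p < 1) (hV : 0 < Fintype.card V) :
    1 - 2 * (Fintype.card V * (1 - p : ℝ) ^ Fintype.card U) -
        Fintype.card U ^ 2 * overlapFactor p d (Fintype.card U) / Fintype.card V ≤
      (SimpleGraph.binomialRandom V p).real {G | HasInducedDominatingCopy H G} := by
  have second_moment := sq_mul_descFactorial_le (V := V) hH hp0 hp1
  have hy := one_le_overlapFactor hp0 hp1 d (Fintype.card U)
  have hq : (0 : ℝ) ≤ 1 - p := sub_nonneg.2 p.2.2
  have prob_nonneg : 0 ≤ (SimpleGraph.binomialRandom V p).real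
    {G | HasInducedDominatingCopy H G} := measureReal_nonneg
  set P := (SimpleGraph.binomialRandom V p).real {G | HasInducedDominatingCopy H G}
  set y := overlapFactor p d (Fintype.card U)
  set N := Fintype.card U
  set n := Fintype.card V
  set α := n * (1 - p : ℝ) ^ N
  set β := N ^ 2 * y / n with hβ
  have hα0 : 0 ≤ α := by positivity
  have hβ0 : 0 ≤ β := by positivity
  by_cases hsmall : α ≤ 1 ∧ β ≤ 1
  · obtain ⟨hα1, hβ1⟩ := hsmall
    have hn : (0 : ℝ) < n := Nat.cast_pos.2 hV
    have hNy : N * y ≤ n := by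
      have le_sq : (N : ℝ) ≤ N ^ 2 := mod_cast Nat.le_self_pow two_ne_zero N
      rw [hβ, div_le_one hn] at hβ1
      exact (mul_le_mul_of_nonneg_right le_sq (by positivity)).trans hβ1
    have hNn : (N : ℝ) ≤ n := (le_mul_of_one_le_right N.cast_nonneg hy).trans hNy
    have base_pos : (0 : ℝ) < n + N * (y - 1) :=
      add_pos_of_pos_of_nonneg hn (mul_nonneg N.cast_nonneg (sub_nonneg.2 hy))
    have sq_mul_le : (1 - α) ^ 2 * (1 - β) ≤ P := by
      refine le_of_mul_le_mul_right ?_ (pow_pos base_pos N)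
      rw [mul_assoc]
      exact (mul_le_mul_of_nonneg_left (one_sub_mul_pow_le_descFactorial hV hy hNy)
        (sq_nonneg _)).trans (second_moment hα1 (mod_cast hNn))
    refine le_trans ?_ sq_mul_le
    nlinarith [mul_nonneg (sq_nonneg α) (sub_nonneg.2 hβ1), mul_nonneg hα0 hβ0]
  · have : 1 < α ∨ 1 < β := by rwa [not_and_or, not_le, not_le] at hsmall
    rcases this with h | h <;> linarith

theorem measureReal_exists_copy_mul_le (hH : HasOrientation H d) :
    (SimpleGraph.binomialRandom V p).real {G | Nonempty (H ↪g G)} *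
        (1 - p : ℝ) ^ (d * Fintype.card U) ≤
      (Fintype.card V : ℝ) ^ Fintype.card U *
        (1 - p : ℝ) ^ (pairs (Finset.univ : Finset U)).card := by
  classical
  have hq : (0 : ℝ) ≤ 1 - p := sub_nonneg.2 p.2.2
  have subset_iUnion : {G : SimpleGraph V | Nonempty (H ↪g G)} ⊆ ⋃ f : U ↪ V, copyEvent H f := by
    rintro G ⟨f⟩
    exact Set.mem_iUnion.2 ⟨f.toEmbedding, fun u v => f.map_adj_iff⟩
  have exists_le : (SimpleGraph.binomialRandom V p).real {G | Nonempty (H ↪g G)} ≤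
      (Fintype.card V : ℝ) ^ Fintype.card U * copyProb H p :=
    calc _ ≤ ∑ f : U ↪ V, (SimpleGraph.binomialRandom V p).real (copyEvent H f) :=
          (measureReal_mono subset_iUnion).trans (measureReal_iUnion_fintype_le _)
      _ = (Fintype.card V).descFactorial (Fintype.card U) * copyProb H p := by
          rw [Finset.sum_eq_card_nsmul fun f _ => measureReal_copyEvent f.injective, nsmul_eq_mul,
            Finset.card_univ, Fintype.card_embedding_eq]
      _ ≤ _ := mul_le_mul_of_nonneg_right (mod_cast Nat.descFactorial_le_pow _ _) copyProb_nonneg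
  calc _ ≤ (Fintype.card V : ℝ) ^ Fintype.card U * copyProb H p *
        (1 - p : ℝ) ^ (d * Fintype.card U) := mul_le_mul_of_nonneg_right exists_le (pow_nonneg hq _)
    _ = (Fintype.card V : ℝ) ^ Fintype.card U *
        (copyProb H p * (1 - p : ℝ) ^ (d * Fintype.card U)) := mul_assoc _ _ _
    _ ≤ _ := mul_le_mul_of_nonneg_left (hH.prod_pairWeight_mul_le Finset.univ) (by positivity)

end Moments

open Filter Topology

/-! ### Asymptotics along two sequences -/

section Asymptotics
-- `s` stands for the sixth root of `1 - p`. Let `N = orderW a` and `n = s⁻¹ ^ (c * N)`. If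
-- `3 < c < 6`, the second moment method applies and a copy of `W_a` dominates; if `6 < c < 9`, no
-- set of `N` vertices dominates and `W_{a+1}`, whose order is at least `3 * N`, does not occur.
-- Hence the two exponents `4` and `8`.
variable {p : unitInterval} {s : ℝ}

/-- The probability that `G(n, p)` has a dominating induced copy of some `W_a`. -/
noncomputable def dominatingCopyProb (p : unitInterval) (n : ℕ) : ℝ :=
  (SimpleGraph.binomialRandom (Fin n) p).real
    {G | ∃ a : ℕ+, HasInducedDominatingCopy (graphW a) G}

theorem inv_pow_mul_pow_eq_one (hs0 : 0 < s) (k : ℕ) : s⁻¹ ^ k * s ^ k = 1 := by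
  rw [← mul_pow, inv_mul_cancel₀ hs0.ne', one_pow]

theorem ceil_inv_pow_mul_le (hs0 : 0 < s) (hs1 : s ≤ 1) (k : ℕ) :
    (⌈s⁻¹ ^ k⌉₊ : ℝ) * s ^ k ≤ 2 := by
  have hsk : 0 < s ^ k := pow_pos hs0 k
  calc (⌈s⁻¹ ^ k⌉₊ : ℝ) * s ^ k ≤ (s⁻¹ ^ k + 1) * s ^ k :=
        mul_le_mul_of_nonneg_right (Nat.ceil_lt_add_one (by positivity)).le hsk.le
    _ = 1 + s ^ k := by rw [add_mul, inv_pow_mul_pow_eq_one hs0, one_mul]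
    _ ≤ 2 := by linarith [pow_le_one₀ (n := k) hs0.le hs1]

theorem one_le_ceil_inv_pow_mul (hs0 : 0 < s) (k : ℕ) : 1 ≤ (⌈s⁻¹ ^ k⌉₊ : ℝ) * s ^ k := by
  rw [← inv_pow_mul_pow_eq_one hs0 k]
  exact mul_le_mul_of_nonneg_right (Nat.le_ceil _) (pow_pos hs0 k).le

theorem ceil_inv_pow_le_exp (hs0 : 0 < s) (hs1 : s ≤ 1) (k : ℕ) :
    (⌈s⁻¹ ^ k⌉₊ : ℝ) ≤ Real.exp (1 + k * Real.log s⁻¹) := by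
  have exp_eq : Real.exp (k * Real.log s⁻¹) = s⁻¹ ^ k := by
    rw [Real.exp_nat_mul, Real.exp_log (inv_pos.2 hs0)]
  refine le_of_mul_le_mul_right ?_ (pow_pos hs0 k)
  rw [Real.exp_add, exp_eq, mul_assoc, inv_pow_mul_pow_eq_one hs0, mul_one]
  linarith [ceil_inv_pow_mul_le hs0 hs1 k, Real.add_one_le_exp (1 : ℝ)]

theorem one_sub_pow_tsub_le_exp {q : ℝ} (hq0 : 0 ≤ q) (hq1 : q ≤ 1) (n M : ℕ) :
    (1 - q) ^ (n - M) ≤ Real.exp (M - q * n) := by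
  have le_tsub : (n : ℝ) - M ≤ (n - M : ℕ) := by
    rw [sub_le_iff_le_add]
    exact_mod_cast le_tsub_add
  calc (1 - q) ^ (n - M) ≤ Real.exp (-q) ^ (n - M) :=
        pow_le_pow_left₀ (sub_nonneg.2 hq1) (Real.one_sub_le_exp_neg q) _
    _ = Real.exp ((n - M : ℕ) * -q) := (Real.exp_nat_mul _ _).symm
    _ ≤ Real.exp (M - q * n) := by
        refine Real.exp_le_exp.2 ?_
        nlinarith [mul_le_of_le_one_left M.cast_nonneg hq1]

theorem pow_mul_one_sub_pow_le (hs0 : 0 < s) (hs1 : s ≤ 1) (M : ℕ) :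
    (⌈s⁻¹ ^ (8 * M)⌉₊ : ℝ) ^ M * (1 - (s ^ 6) ^ M) ^ (⌈s⁻¹ ^ (8 * M)⌉₊ - M) ≤
      Real.exp ((2 + 8 * Real.log s⁻¹) * (M : ℝ) ^ 2 - (s⁻¹ ^ 2) ^ M) := by
  have hq0 : 0 ≤ (s ^ 6) ^ M := by positivity
  have hq1 : (s ^ 6) ^ M ≤ 1 := pow_le_one₀ (by positivity) (pow_le_one₀ hs0.le hs1)
  have le_sq : (M : ℝ) ≤ (M : ℝ) ^ 2 := mod_cast Nat.le_self_pow two_ne_zero M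
  have inv_pow_le : (s⁻¹ ^ 2) ^ M ≤ (s ^ 6) ^ M * ⌈s⁻¹ ^ (8 * M)⌉₊ := by
    refine le_of_mul_le_mul_right (a := s ^ (2 * M)) ?_ (by positivity)
    calc (s⁻¹ ^ 2) ^ M * s ^ (2 * M) = 1 := by
          rw [← pow_mul, inv_pow_mul_pow_eq_one hs0]
      _ ≤ ⌈s⁻¹ ^ (8 * M)⌉₊ * s ^ (8 * M) := one_le_ceil_inv_pow_mul hs0 _
      _ = _ := by ring
  calc _ ≤ Real.exp (1 + (8 * M : ℕ) * Real.log s⁻¹) ^ M *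
          Real.exp (M - (s ^ 6) ^ M * ⌈s⁻¹ ^ (8 * M)⌉₊) := by
        gcongr
        · exact ceil_inv_pow_le_exp hs0 hs1 _
        · exact one_sub_pow_tsub_le_exp hq0 hq1 _ _
    _ = Real.exp (2 * M + 8 * Real.log s⁻¹ * M ^ 2 - (s ^ 6) ^ M * ⌈s⁻¹ ^ (8 * M)⌉₊) := by
        rw [← Real.exp_nat_mul, ← Real.exp_add]
        push_cast
        ring_nf
    _ ≤ _ := Real.exp_le_exp.2 (by linarith)

theorem ceil_inv_pow_mul_pow_le (hs0 : 0 < s) (hs1 : s ≤ 1) (N : ℕ) :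
    ⌈s⁻¹ ^ (4 * N)⌉₊ * (s ^ 6) ^ N ≤ 2 * s ^ N :=
  calc ⌈s⁻¹ ^ (4 * N)⌉₊ * (s ^ 6) ^ N = ⌈s⁻¹ ^ (4 * N)⌉₊ * s ^ (4 * N) * (s ^ N * s ^ N) := by ring
    _ ≤ 2 * (s ^ N * 1) := by
        gcongr
        · exact ceil_inv_pow_mul_le hs0 hs1 _
        · exact pow_le_one₀ hs0.le hs1
    _ = 2 * s ^ N := by rw [mul_one]

theorem inv_pow_div_ceil_inv_pow_le (hs0 : 0 < s) (N : ℕ) :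
    ((s ^ 3) ^ N)⁻¹ / ⌈s⁻¹ ^ (4 * N)⌉₊ ≤ s ^ N := by
  have ceil_pos : (0 : ℝ) < ⌈s⁻¹ ^ (4 * N)⌉₊ := Nat.cast_pos.2 (Nat.ceil_pos.2 (by positivity))
  rw [div_le_iff₀ ceil_pos, inv_le_iff_one_le_mul₀ (by positivity)]
  calc 1 ≤ ⌈s⁻¹ ^ (4 * N)⌉₊ * s ^ (4 * N) := one_le_ceil_inv_pow_mul hs0 _
    _ = s ^ N * ⌈s⁻¹ ^ (4 * N)⌉₊ * (s ^ 3) ^ N := by ring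

theorem le_dominatingCopyProb (hp0 : 0 < p) (hp1 : p < 1) (hs0 : 0 < s) (hs1 : s ≤ 1)
    (hs : s ^ 6 = 1 - p) (a : ℕ+) :
    1 - 4 * s ^ orderW a - ((p : ℝ) ^ 2)⁻¹ * ((orderW a : ℝ) ^ 2 * s ^ orderW a) ≤
      dominatingCopyProb p ⌈s⁻¹ ^ (4 * orderW a)⌉₊ := by
  have := Fintype.ofFinite (VertexW a)
  set n := ⌈s⁻¹ ^ (4 * orderW a)⌉₊
  set N := orderW a
  have hp : (0 : ℝ) < p := hp0
  have hn : 0 < n := Nat.ceil_pos.2 (by positivity)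
  have second_moment := le_measureReal_hasInducedDominatingCopy (V := Fin n)
    (hasOrientation_graphW a) hp0 hp1 (by simpa using hn)
  have sqrt_eq : √(1 - p : ℝ) = s ^ 3 := by
    rw [← hs, show s ^ 6 = (s ^ 3) ^ 2 by ring, Real.sqrt_sq (by positivity)]
  rw [← Nat.card_eq_fintype_card (α := VertexW a), Fintype.card_fin, overlapFactor, sqrt_eq,
    ← hs] at second_moment
  change 1 - 2 * (n * (s ^ 6) ^ N) - N ^ 2 * ((s ^ 3) ^ N * (p : ℝ) ^ 2)⁻¹ / n ≤ _
    at second_moment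
  have overlap_le : N ^ 2 * ((s ^ 3) ^ N * (p : ℝ) ^ 2)⁻¹ / n ≤
      ((p : ℝ) ^ 2)⁻¹ * ((N : ℝ) ^ 2 * s ^ N) :=
    calc _ = ((p : ℝ) ^ 2)⁻¹ * (N ^ 2 * (((s ^ 3) ^ N)⁻¹ / n)) := by rw [mul_inv]; ring
      _ ≤ _ := by
          gcongr
          exact inv_pow_div_ceil_inv_pow_le hs0 N
  calc _ ≤ _ := by linarith [ceil_inv_pow_mul_pow_le hs0 hs1 N]
    _ ≤ _ := second_moment
    _ ≤ _ := measureReal_mono fun G hG => Exists.intro a hG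

theorem measureReal_exists_graphW_mul_le {V : Type*} [Fintype V] (hs0 : 0 < s) (hs : s ^ 6 = 1 - p)
    (a : ℕ+) :
    (SimpleGraph.binomialRandom V p).real {G | Nonempty (graphW a ↪g G)} *
        (s ^ 15) ^ orderW a ≤ (Fintype.card V * s ^ (3 * orderW a)) ^ orderW a := by
  have := Fintype.ofFinite (VertexW a)
  have first_moment := measureReal_exists_copy_mul_le (V := V) (p := p) (hasOrientation_graphW a)
  have card_pairs := two_mul_card_pairs (Finset.univ : Finset (VertexW a))
  rw [Finset.card_univ, Nat.mul_sub_one] at card_pairs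
  rw [← hs] at first_moment
  rw [show orderW a = Fintype.card (VertexW a) from Nat.card_eq_fintype_card]
  set N := Fintype.card (VertexW a)
  set K := (pairs (Finset.univ : Finset (VertexW a))).card
  have exponent_eq : 6 * K + 3 * N = 3 * N * N := by
    have := Nat.le_mul_self N
    rw [mul_assoc]
    omega
  calc _ = (SimpleGraph.binomialRandom V p).real {G | Nonempty (graphW a ↪g G)} *
          (s ^ 6) ^ (2 * N) * s ^ (3 * N) := by ring
    _ ≤ Fintype.card V ^ N * (s ^ 6) ^ K * s ^ (3 * N) :=
        mul_le_mul_of_nonneg_right first_moment (by positivity)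
    _ = Fintype.card V ^ N * s ^ (6 * K + 3 * N) := by rw [← pow_mul, mul_assoc, ← pow_add]
    _ = _ := by rw [exponent_eq, mul_pow, ← pow_mul]

theorem measureReal_exists_graphW_succ_le (hs0 : 0 < s) (hs1 : s ≤ 1)
    (hs : s ^ 6 = 1 - p) (a : ℕ+) :
    (SimpleGraph.binomialRandom (Fin ⌈s⁻¹ ^ (8 * orderW a)⌉₊) p).real
      {G | Nonempty (graphW (a + 1) ↪g G)} ≤ 2 * s⁻¹ ^ 15 * s ^ orderW a := by
  have first_moment := measureReal_exists_graphW_mul_le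
    (V := Fin ⌈s⁻¹ ^ (8 * orderW a)⌉₊) hs0 hs (a + 1)
  have prob_le_one : (SimpleGraph.binomialRandom (Fin ⌈s⁻¹ ^ (8 * orderW a)⌉₊) p).real
    {G | Nonempty (graphW (a + 1) ↪g G)} ≤ 1 := measureReal_le_one
  set P := (SimpleGraph.binomialRandom (Fin ⌈s⁻¹ ^ (8 * orderW a)⌉₊) p).real
    {G | Nonempty (graphW (a + 1) ↪g G)}
  have order_le : 9 * orderW a ≤ 3 * orderW (a + 1) := by linarith [three_mul_orderW_le a]
  have order_ne_zero : orderW (a + 1) ≠ 0 :=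
    ((Nat.succ_pos a).trans_le (le_orderW (a + 1))).ne'
  set M := orderW a
  set N := orderW (a + 1)
  set B := 2 * s⁻¹ ^ 15 * s ^ M
  rcases le_total B 1 with hB | hB
  · have base_le : ⌈s⁻¹ ^ (8 * M)⌉₊ * s ^ (3 * N) ≤ B * s ^ 15 :=
      calc _ ≤ ⌈s⁻¹ ^ (8 * M)⌉₊ * s ^ (9 * M) := by
            exact mul_le_mul_of_nonneg_left (pow_le_pow_of_le_one hs0.le hs1 order_le)
              (Nat.cast_nonneg _)
        _ = ⌈s⁻¹ ^ (8 * M)⌉₊ * s ^ (8 * M) * s ^ M := by ring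
        _ ≤ 2 * s ^ M := by
            gcongr
            exact ceil_inv_pow_mul_le hs0 hs1 _
        _ = 2 * (s⁻¹ ^ 15 * s ^ 15) * s ^ M := by rw [inv_pow_mul_pow_eq_one hs0, mul_one]
        _ = B * s ^ 15 := by ring
    have prob_le_pow : P ≤ B ^ N := by
      refine le_of_mul_le_mul_right ?_ (by positivity : 0 < (s ^ 15) ^ N)
      rw [← mul_pow]
      rw [Fintype.card_fin] at first_moment
      exact first_moment.trans (pow_le_pow_left₀ (by positivity) base_le N)
    exact prob_le_pow.trans (pow_le_of_le_one (by positivity) hB order_ne_zero)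
  · exact prob_le_one.trans hB

theorem dominatingCopyProb_le (hs0 : 0 < s) (hs1 : s ≤ 1) (hs : s ^ 6 = 1 - p) (a : ℕ+) :
    dominatingCopyProb p ⌈s⁻¹ ^ (8 * orderW a)⌉₊ ≤
      Real.exp ((2 + 8 * Real.log s⁻¹) * (orderW a : ℝ) ^ 2 - (s⁻¹ ^ 2) ^ orderW a) +
        2 * s⁻¹ ^ 15 * s ^ orderW a := by
  classical
  set n := ⌈s⁻¹ ^ (8 * orderW a)⌉₊
  have subset_union : {G : SimpleGraph (Fin n) | ∃ a : ℕ+, HasInducedDominatingCopy (graphW a) G} ⊆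
      {G | ∃ T : Finset (Fin n), T.Nonempty ∧ T.card ≤ orderW a ∧ G ∈ dominatingEvent T} ∪
        {G | Nonempty (graphW (a + 1) ↪g G)} := by
    rintro G ⟨b, f, hf⟩
    rcases le_or_gt b a with hba | hab
    · have := Fintype.ofFinite (VertexW b)
      refine Or.inl ⟨Finset.univ.image f, ⟨f (.inl ⟨0, b.pos⟩), by simp⟩, ?_, fun v hv => ?_⟩
      · rw [Finset.card_image_of_injective _ f.injective, Finset.card_univ,
          ← Nat.card_eq_fintype_card]
        exact orderW_mono hba
      · obtain ⟨u, hu⟩ := hf v (by simpa using hv)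
        exact ⟨f u, by simp, hu⟩
    · exact Or.inr ⟨f.comp (graphWEmbedding (PNat.add_one_le_iff.2 hab))⟩
  have dominating_le := measureReal_exists_dominating_le (V := Fin n) (p := p) (orderW a)
  rw [Fintype.card_fin, ← hs] at dominating_le
  calc _ ≤ _ := measureReal_mono subset_union
    _ ≤ _ := measureReal_union_le _ _
    _ ≤ _ := add_le_add (dominating_le.trans (pow_mul_one_sub_pow_le hs0 hs1 _))
        (measureReal_exists_graphW_succ_le hs0 hs1 hs a)

theorem tendsto_orderW_succPNat : Tendsto (fun k : ℕ => orderW k.succPNat) atTop atTop :=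
  tendsto_atTop_mono (fun k => (Nat.le_succ k).trans (le_orderW k.succPNat)) tendsto_id

theorem tendsto_ceil_inv_pow (hs0 : 0 < s) (hs1 : s < 1) {c : ℕ} (hc : c ≠ 0) :
    Tendsto (fun N : ℕ => ⌈s⁻¹ ^ (c * N)⌉₊) atTop atTop := by
  simp only [pow_mul]
  exact tendsto_nat_ceil_atTop.comp
    (tendsto_pow_atTop_atTop_of_one_lt (one_lt_pow₀ ((one_lt_inv₀ hs0).2 hs1) hc))

theorem tendsto_exp_mul_sq_sub_pow {t : ℝ} (ht : 1 < t) (C : ℝ) :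
    Tendsto (fun N : ℕ => Real.exp (C * (N : ℝ) ^ 2 - t ^ N)) atTop (𝓝 0) := by
  have ratio : Tendsto (fun N : ℕ => C * ((N : ℝ) ^ 2 / t ^ N) - 1) atTop (𝓝 (-1)) := by
    simpa using ((tendsto_pow_const_div_const_pow_of_one_lt 2 ht).const_mul C).sub_const 1
  refine Real.tendsto_exp_atBot.comp
    (((tendsto_pow_atTop_atTop_of_one_lt ht).atTop_mul_neg neg_one_lt_zero ratio).congr fun N => ?_)
  have : t ^ N ≠ 0 := by positivity
  field_simp

theorem tendsto_dominatingCopyProb_one (hp0 : 0 < p) (hp1 : p < 1) (hs0 : 0 < s) (hs1 : s < 1)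
    (hs : s ^ 6 = 1 - p) :
    Tendsto (fun k : ℕ => dominatingCopyProb p ⌈s⁻¹ ^ (4 * orderW k.succPNat)⌉₊) atTop (𝓝 1) := by
  have lower_bound : Tendsto (fun N : ℕ => 1 - 4 * s ^ N - ((p : ℝ) ^ 2)⁻¹ * ((N : ℝ) ^ 2 * s ^ N))
      atTop (𝓝 1) := by
    have abs_lt : |s| < 1 := by rwa [abs_of_pos hs0]
    simpa using (((tendsto_pow_atTop_nhds_zero_of_lt_one hs0.le hs1).const_mul 4).const_sub 1).sub
      ((tendsto_pow_const_mul_const_pow_of_abs_lt_one 2 abs_lt).const_mul ((p : ℝ) ^ 2)⁻¹)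
  exact tendsto_of_tendsto_of_tendsto_of_le_of_le (lower_bound.comp tendsto_orderW_succPNat)
    tendsto_const_nhds (fun k => le_dominatingCopyProb hp0 hp1 hs0 hs1.le hs k.succPNat)
    fun k => measureReal_le_one

theorem tendsto_dominatingCopyProb_zero (hs0 : 0 < s) (hs1 : s < 1) (hs : s ^ 6 = 1 - p) :
    Tendsto (fun k : ℕ => dominatingCopyProb p ⌈s⁻¹ ^ (8 * orderW k.succPNat)⌉₊) atTop (𝓝 0) := by
  have upper_bound : Tendsto (fun N : ℕ => Real.exp ((2 + 8 * Real.log s⁻¹) * (N : ℝ) ^ 2 -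
      (s⁻¹ ^ 2) ^ N) + 2 * s⁻¹ ^ 15 * s ^ N) atTop (𝓝 0) := by
    have one_lt : 1 < s⁻¹ ^ 2 := one_lt_pow₀ ((one_lt_inv₀ hs0).2 hs1) two_ne_zero
    simpa only [mul_zero, add_zero] using
      (tendsto_exp_mul_sq_sub_pow one_lt (2 + 8 * Real.log s⁻¹)).add
        ((tendsto_pow_atTop_nhds_zero_of_lt_one hs0.le hs1).const_mul (2 * s⁻¹ ^ 15))
  exact squeeze_zero (fun _ => measureReal_nonneg)
    (fun k => dominatingCopyProb_le hs0 hs1.le hs k.succPNat)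
    (upper_bound.comp tendsto_orderW_succPNat)

theorem not_converges_dominatingCopyProb (hp0 : 0 < p) (hp1 : p < 1) :
    ¬ Converges (dominatingCopyProb p) := by
  rintro ⟨L, hL⟩
  have hp : (0 : ℝ) < p := hp0
  have hq : (0 : ℝ) < 1 - p := sub_pos.2 hp1
  set s : ℝ := (1 - p : ℝ) ^ ((6 : ℕ) : ℝ)⁻¹
  have hs0 : 0 < s := Real.rpow_pos_of_pos hq _
  have hs1 : s < 1 := Real.rpow_lt_one hq.le (by linarith) (by positivity)
  have hs : s ^ 6 = 1 - p := Real.rpow_inv_natCast_pow hq.le (by norm_num)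
  have tendsto_limit (c : ℕ) (hc : c ≠ 0) :
      Tendsto (fun k : ℕ => dominatingCopyProb p ⌈s⁻¹ ^ (c * orderW k.succPNat)⌉₊) atTop (𝓝 L) :=
    hL.comp ((tendsto_ceil_inv_pow hs0 hs1 hc).comp tendsto_orderW_succPNat)
  have limit_eq_one : L = 1 := tendsto_nhds_unique (tendsto_limit 4 four_ne_zero)
    (tendsto_dominatingCopyProb_one hp0 hp1 hs0 hs1 hs)
  have limit_eq_zero : L = 0 := tendsto_nhds_unique (tendsto_limit 8 (by norm_num))
    (tendsto_dominatingCopyProb_zero hs0 hs1 hs)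
  exact one_ne_zero (limit_eq_one.symm.trans limit_eq_zero)

theorem not_converges_prob {m k : ℕ} {φ : EMSOSentence m k} (hp0 : 0 < p) (hp1 : p < 1)
    (hφ : ∀ (V : Type) [Finite V] [Nonempty V] (G : SimpleGraph V),
      φ.Models G ↔ ∃ a : ℕ+, HasInducedDominatingCopy (graphW a) G) :
    ¬ Converges (prob φ p) := by
  rintro ⟨L, hL⟩
  refine not_converges_dominatingCopyProb hp0 hp1 ⟨L, hL.congr' ?_⟩
  filter_upwards [eventually_gt_atTop 0] with n hn
  have : Nonempty (Fin n) := ⟨⟨0, hn⟩⟩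
  simp only [prob, dominatingCopyProb, hφ]

end Asymptotics

end EMSOGraph

theorem theorem3 (p : unitInterval) (hp0 : 0 < p) (hp1 : p < 1) :
    (∃ (k : ℕ) (φ₁ : EMSOGraph.EMSOSentence 1 k),
      (∀ (V : Type) [Finite V] [Nonempty V] (G : SimpleGraph V),
        φ₁.Models G ↔ ∃ a : ℕ+, EMSOGraph.HasInducedDominatingCopy (EMSOGraph.graphW a) G) ∧
      ¬ EMSOGraph.Converges (EMSOGraph.prob φ₁ p)) ∧
    (∃ (m : ℕ) (φ₂ : EMSOGraph.EMSOSentence m 3),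
      ¬ EMSOGraph.Converges (EMSOGraph.prob φ₂ p)) :=
  ⟨⟨19, EMSOGraph.oneSetFormula.toSentence, fun _ _ _ G => EMSOGraph.oneSet_models_iff G,
      EMSOGraph.not_converges_prob hp0 hp1 fun _ _ _ G => EMSOGraph.oneSet_models_iff G⟩,
    9, EMSOGraph.threeVariableFormula.toSentence,
    EMSOGraph.not_converges_prob hp0 hp1 fun _ _ _ G => EMSOGraph.threeVariables_models_iff G⟩
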